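/- Let $d\ge 1$, let $D\subset\mathbb R^d$ be open and bounded, put $H=L^2(D)$, and let $A$ be the realization in $H$ of the Laplace operator with Dirichlet boundary conditions ($u\in D(A)$, $Au=f$ iff $u\in H^1_0(D)$ and $\Delta u=f\in H$ in the sense of distributions). Let $\{e_k\}_{k\ge1}$ be a complete orthonormal system of $H$ with $Ae_k=-\alpha_ke_k$, $0<\alpha_1\le\alpha_2\le\dots$, and assume that $D$ is regular enough that $C^{-1}k^{2/d}\le\alpha_k\le Ck^{2/d}$ for all $k$, for some $C>0$. For $\delta\in\mathbb R$ let $H^\delta$ be the Hilbert space of all $x=\sum_kx_ke_k$ with $|x|_{H^\delta}^2=\sum_k\alpha_k^\delta x_k^2<\infty$, and let $\mathcal H=H\times H^{-1}$. Let $Q$ be a bounded linear operator on $H$ with $Qe_k=\lambda_ke_k$ and $\frac1c\alpha_k^{-\beta}\le\lambda_k\le c\,\alpha_k^{-\beta}$ for all $k$, for some $c>0$ and $\beta>(d-2)/4$. Let $B:H\to H$ satisfy $B(0)=0$ and, for every $\delta\in[0,1+2\beta]$, let $B$ map $H^\delta$ into itself and be Lipschitz continuous there with Lipschitz constant $\gamma_\delta<\alpha_1$.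 For $\mu>0$ let $S_\mu(t)$ be the semigroup on $\mathcal H$ generated by $A_\mu(u,v)=\big(v,\tfrac1\mu(Au-v)\big)$, and let $B_\mu(u,v)=\tfrac1\mu(0,B(u))$, $Q_\mu h=\tfrac1\mu(0,Qh)$. For $t_1<t_2$ and $z\in C([t_1,t_2];\mathcal H)$ define $$I^\mu_{t_1,t_2}(z)=\tfrac12\inf|\psi|^2_{L^2((t_1,t_2);H)}\in[0,\infty],$$ where the infimum is over all $\psi\in L^2((t_1,t_2);H)$ such that $z$ is a mild solution of $z'=A_\mu z+B_\mu(z)+Q_\mu\psi$, that is, $$z(t)=S_\mu(t-t_1)z(t_1)+\int_{t_1}^tS_\mu(t-s)\big[B_\mu(z(s))+Q_\mu\psi(s)\big]\,ds,\qquad t_1\le t\le t_2$$ (and $\inf\emptyset=+\infty$). For $z\in C((-\infty,0];\mathcal H)$ let $I^\mu_{-\infty}(z)=\sup_{t>0}I^\mu_{-t,0}(z)$, and for $r>0$ let $$K^\mu_{-\infty}(r)=\Big\{z\in C((-\infty,0];\mathcal H)\ :\ \lim_{t\to-\infty}|z(t)|_{\mathcal H}=0,\ I^\mu_{-\infty}(z)\le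 r\Big\}.$$ Then there exists $\mu_0>0$ such that for every $0<\mu\le\mu_0$ and every $r>0$ the set $K^\mu_{-\infty}(r)$ is compact in $C((-\infty,0];\mathcal H)$ endowed with the topology of uniform convergence on bounded intervals. -/

import Mathlib

noncomputable section

open MeasureTheory Set Filter Topology
open scoped ENNReal ContDiff

namespace DampedWave

/-! ### The Dirichlet Laplacian on a domain -/

/-- `L²(D)` for a set `D ⊆ ℝᵈ` with Lebesgue measure; the space `H`. -/
abbrev L2 {d : ℕ} (D : Set (EuclideanSpace ℝ (Fin d))) : Type :=
  Lp ℝ 2 (volume.restrict D)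

/-- `φ ∈ C_c^∞(D)`. -/
structure IsTestFunction {d : ℕ} (D : Set (EuclideanSpace ℝ (Fin d)))
    (φ : EuclideanSpace ℝ (Fin d) → ℝ) : Prop where
  smooth : ContDiff ℝ ∞ φ
  compact : HasCompactSupport φ
  support : tsupport φ ⊆ D

/-- `u ∈ H¹₀(D)` with (weak) gradient `g`: the pair `(u, g)` is a limit in `L²` of pairs `(φₙ, ∇φₙ)`
with `φₙ ∈ C_c^∞(D)`. -/
def HasH10Gradient {d : ℕ} (D : Set (EuclideanSpace ℝ (Fin d))) (u : L2 D)
    (g : Lp (EuclideanSpace ℝ (Fin d)) 2 (volume.restrict D)) : Prop :=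
  ∃ φ : ℕ → EuclideanSpace ℝ (Fin d) → ℝ, (∀ n, IsTestFunction D (φ n)) ∧
    Tendsto (fun n => eLpNorm (fun x => φ n x - u x) 2 (volume.restrict D)) atTop (𝓝 0) ∧
    Tendsto (fun n => eLpNorm (fun x => gradient (φ n) x - g x) 2 (volume.restrict D))
      atTop (𝓝 0)

/-- The graph of the realization `A` in `L²(D)` of the Laplace operator with Dirichlet boundary
conditions: `u ∈ D(A)` and `A u = f` iff `u ∈ H¹₀(D)` and `Δu = f` in the sense of distributions. -/
def IsDirichletLaplacian {d : ℕ} (D : Set (EuclideanSpace ℝ (Fin d))) (u f : L2 D) : Prop :=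
  ∃ g : Lp (EuclideanSpace ℝ (Fin d)) 2 (volume.restrict D), HasH10Gradient D u g ∧
    ∀ φ : EuclideanSpace ℝ (Fin d) → ℝ, IsTestFunction D φ →
      ∫ x in D, inner ℝ (g x) (gradient φ x) = - ∫ x in D, f x * φ x

/-- A complete orthonormal system `e` of eigenfunctions of the Dirichlet Laplacian `A`, with
`A eₖ = -αₖ eₖ` and `0 < α₀ ≤ α₁ ≤ …` (numbered from `0`). -/
structure DirichletEigensystem {d : ℕ} (D : Set (EuclideanSpace ℝ (Fin d))) where
  e : HilbertBasis ℕ ℝ (L2 D)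
  α : ℕ → ℝ
  first_pos : 0 < α 0
  mono : Monotone α
  eigen : ∀ k, IsDirichletLaplacian D (e k) (-(α k) • e k)

variable {d : ℕ} {D : Set (EuclideanSpace ℝ (Fin d))}

namespace DirichletEigensystem

theorem pos (S : DirichletEigensystem D) (k : ℕ) : 0 < S.α k :=
  S.first_pos.trans_le (S.mono (Nat.zero_le k))

/-- The coordinates `⟨u, eₖ⟩` of `u ∈ L²(D)`. -/
def coeff (S : DirichletEigensystem D) (u : L2 D) (k : ℕ) : ℝ := S.e.repr u k

theorem summable_coeff_sq (S : DirichletEigensystem D) (u : L2 D) :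
    Summable fun k => S.coeff u k ^ 2 := by
  have h := (memℓp_gen_iff (p := 2) (by norm_num)).1 (lp.memℓp (S.e.repr u))
  simpa [coeff] using h

theorem norm_sq_eq_tsum (S : DirichletEigensystem D) (u : L2 D) :
    ‖u‖ ^ 2 = ∑' k, S.coeff u k ^ 2 := by
  rw [← S.e.repr.norm_map u]
  have h := lp.norm_rpow_eq_tsum (p := 2) (by norm_num) (S.e.repr u)
  simpa [coeff] using h

/-- The element of `L²(D)` with given square-summable coordinates. -/
def ofCoeff (S : DirichletEigensystem D) (a : ℕ → ℝ) (ha : Summable fun k => a k ^ 2) : L2 D :=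
  S.e.repr.symm ⟨a, (memℓp_gen_iff (p := 2) (by norm_num)).2 (by simpa using ha)⟩

@[simp] theorem coeff_ofCoeff (S : DirichletEigensystem D) (a : ℕ → ℝ)
    (ha : Summable fun k => a k ^ 2) (k : ℕ) : S.coeff (S.ofCoeff a ha) k = a k := by
  simp [coeff, ofCoeff]

theorem ext_coeff (S : DirichletEigensystem D) {u v : L2 D}
    (h : ∀ k, S.coeff u k = S.coeff v k) : u = v :=
  S.e.repr.injective (lp.ext (funext h))

end DirichletEigensystem

/-! ### The scale of Hilbert spaces `H^δ` -/

/-- The coordinate sequences with `∑ₖ αₖ^δ xₖ² < ∞`. -/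
def scaleSubmodule (S : DirichletEigensystem D) (δ : ℝ) : Submodule ℝ (ℕ → ℝ) where
  carrier := {x | Summable fun k => S.α k ^ δ * x k ^ 2}
  zero_mem' := by simp
  add_mem' := by
    intro x y hx hy
    refine Summable.of_nonneg_of_le
      (fun k => mul_nonneg (Real.rpow_nonneg (S.pos k).le _) (sq_nonneg _)) (fun k => ?_)
      ((hx.mul_left 2).add (hy.mul_left 2))
    have h := mul_nonneg (Real.rpow_nonneg (S.pos k).le δ) (sq_nonneg (x k - y k))
    simp only [Pi.add_apply]
    nlinarith
  smul_mem' := by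
    intro c x hx
    refine (Summable.mul_left (c ^ 2) hx).congr (fun k => ?_)
    simp only [Pi.smul_apply, smul_eq_mul]
    ring

/-- The Hilbert space `H^δ`, `δ ∈ ℝ`: an element is the sequence `(xₖ)` of its coordinates with
respect to the eigenfunctions `eₖ`, and `|x|²_{H^δ} = ∑ₖ αₖ^δ xₖ² < ∞`. -/
def HScale (S : DirichletEigensystem D) (δ : ℝ) : Type := ↥(scaleSubmodule S δ)

namespace HScale

variable {S : DirichletEigensystem D} {δ : ℝ}

instance : AddCommGroup (HScale S δ) := inferInstanceAs (AddCommGroup ↥(scaleSubmodule S δ))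

instance : Module ℝ (HScale S δ) := inferInstanceAs (Module ℝ ↥(scaleSubmodule S δ))

/-- The coordinates of an element of `H^δ`. -/
def coeff (x : HScale S δ) : ℕ → ℝ := x.1

theorem summable (x : HScale S δ) : Summable fun k => S.α k ^ δ * x.coeff k ^ 2 := x.2

@[ext] theorem ext {x y : HScale S δ} (h : ∀ k, x.coeff k = y.coeff k) : x = y :=
  Subtype.ext (funext h)

/-- The element of `H^δ` with given coordinates. -/
def mk (a : ℕ → ℝ) (ha : Summable fun k => S.α k ^ δ * a k ^ 2) : HScale S δ := ⟨a, ha⟩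

@[simp] theorem coeff_mk (a : ℕ → ℝ) (ha : Summable fun k => S.α k ^ δ * a k ^ 2) :
    (mk a ha : HScale S δ).coeff = a := rfl

@[simp] theorem coeff_add (x y : HScale S δ) (k : ℕ) :
    (x + y).coeff k = x.coeff k + y.coeff k := rfl

@[simp] theorem coeff_smul (c : ℝ) (x : HScale S δ) (k : ℕ) :
    (c • x).coeff k = c * x.coeff k := rfl

theorem weight_sq (S : DirichletEigensystem D) (δ a : ℝ) (k : ℕ) :
    (S.α k ^ (δ / 2) * a) ^ 2 = S.α k ^ δ * a ^ 2 := by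
  rw [mul_pow, ← Real.rpow_mul_natCast (S.pos k).le]
  norm_num

/-- The isometry `(xₖ) ↦ (αₖ^{δ/2} xₖ)` of `H^δ` onto `ℓ²`, from which `H^δ` takes its norm. -/
def toEll2 (S : DirichletEigensystem D) (δ : ℝ) :
    HScale S δ ≃ₗ[ℝ] lp (fun _ : ℕ => ℝ) 2 where
  toFun x := ⟨fun k => S.α k ^ (δ / 2) * x.coeff k, (memℓp_gen_iff (p := 2) (by norm_num)).2 (by
    simpa [mul_pow, ← weight_sq S δ] using x.summable)⟩
  invFun y := mk (fun k => S.α k ^ (-(δ / 2)) * y k) (by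
    have h := (memℓp_gen_iff (p := 2) (by norm_num)).1 (lp.memℓp y)
    refine (show Summable fun k => (y k) ^ 2 by simpa using h).congr (fun k => ?_)
    rw [← weight_sq S δ, ← mul_assoc, ← Real.rpow_add (S.pos k)]
    simp)
  left_inv x := by
    ext k
    simp [← mul_assoc, ← Real.rpow_add (S.pos k)]
  right_inv y := by
    ext k
    simp [← mul_assoc, ← Real.rpow_add (S.pos k)]
  map_add' x y := by
    ext k
    exact mul_add _ _ _
  map_smul' c x := by
    ext k
    simp [mul_left_comm]

instance : NormedAddCommGroup (HScale S δ) :=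
  NormedAddCommGroup.induced (HScale S δ) (lp (fun _ : ℕ => ℝ) 2) (toEll2 S δ)
    (toEll2 S δ).injective

instance : NormedSpace ℝ (HScale S δ) :=
  NormedSpace.induced ℝ (HScale S δ) (lp (fun _ : ℕ => ℝ) 2) (toEll2 S δ)

theorem norm_sq (x : HScale S δ) : ‖x‖ ^ 2 = ∑' k, S.α k ^ δ * x.coeff k ^ 2 := by
  have h := lp.norm_rpow_eq_tsum (p := 2) (by norm_num) (toEll2 S δ x)
  have h2 : ‖x‖ = ‖toEll2 S δ x‖ := rfl
  rw [h2]
  simpa [toEll2, mul_pow, ← weight_sq S δ] using h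

instance : CompleteSpace (HScale S δ) := by
  let f : HScale S δ ≃ₗᵢ[ℝ] lp (fun _ : ℕ => ℝ) 2 := ⟨toEll2 S δ, fun _ => rfl⟩
  exact (completeSpace_congr (e := f.toEquiv) f.isometry.isUniformEmbedding).2 inferInstance

end HScale

/-- The phase space `𝓗 = L²(D) × H⁻¹`, with the Hilbertian product norm. -/
abbrev PhaseSpace (S : DirichletEigensystem D) : Type := WithLp 2 (L2 D × HScale S (-1))

/-- The inclusion `L²(D) ⊆ H⁻¹`. -/
def inclusion (S : DirichletEigensystem D) : L2 D →ₗ[ℝ] HScale S (-1) where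
  toFun u := HScale.mk (S.coeff u) (by
    refine Summable.of_nonneg_of_le
      (fun k => mul_nonneg (Real.rpow_nonneg (S.pos k).le _) (sq_nonneg _)) (fun k => ?_)
      ((S.summable_coeff_sq u).mul_left (S.α 0)⁻¹)
    rw [Real.rpow_neg_one]
    have := S.first_pos
    gcongr
    exact S.mono (Nat.zero_le k))
  map_add' u v := by
    ext k
    simp [DirichletEigensystem.coeff]
  map_smul' c u := by
    ext k
    simp [DirichletEigensystem.coeff]

/-! ### The semigroup of the damped wave equation -/

/-- The action of `A_μ (u, v) = (v, (A u - v) / μ)` on the coordinates of an eigenfunction of `A`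
with eigenvalue `-a`. -/
def modeGenerator (μ a : ℝ) : ℝ × ℝ →L[ℝ] ℝ × ℝ :=
  (ContinuousLinearMap.snd ℝ ℝ ℝ).prod
    ((1 / μ) • (-a • ContinuousLinearMap.fst ℝ ℝ ℝ - ContinuousLinearMap.snd ℝ ℝ ℝ))

/-- The restriction of `S_μ(t) = exp (t A_μ)` to such a mode. -/
def modeFlow (μ a t : ℝ) : ℝ × ℝ →L[ℝ] ℝ × ℝ := NormedSpace.exp (t • modeGenerator μ a)

theorem modeFlow_zero (μ a : ℝ) (p : ℝ × ℝ) : modeFlow μ a 0 p = p := by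
  simp [modeFlow]

theorem hasDerivAt_modeFlow (μ a t : ℝ) (p : ℝ × ℝ) :
    HasDerivAt (fun s => modeFlow μ a s p) (modeGenerator μ a (modeFlow μ a t p)) t := by
  have h := hasDerivAt_exp_smul_const' (𝕂 := ℝ) (modeGenerator μ a) t
  exact h.clm_apply (hasDerivAt_const t p) |>.congr_deriv (by simp [modeFlow])

/-- The energy of a mode is controlled uniformly in the mode. -/
theorem modeFlow_energy {μ a : ℝ} (hμ : 0 < μ) (ha : 0 < a) (t : ℝ) (p : ℝ × ℝ) :
    (modeFlow μ a t p).1 ^ 2 + μ / a * (modeFlow μ a t p).2 ^ 2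
      ≤ Real.exp (2 * |t| / μ) * (p.1 ^ 2 + μ / a * p.2 ^ 2) := by
  set E : ℝ → ℝ := fun s => (modeFlow μ a s p).1 ^ 2 + μ / a * (modeFlow μ a s p).2 ^ 2 with hE
  have h0 : E 0 = p.1 ^ 2 + μ / a * p.2 ^ 2 := by simp [hE, modeFlow_zero]
  have hEn : ∀ s, 0 ≤ E s := fun s => by positivity
  have hd : ∀ s, HasDerivAt E (-(2 / a) * (modeFlow μ a s p).2 ^ 2) s := by
    intro s
    have h := hasDerivAt_modeFlow μ a s p
    have h1 : HasDerivAt (fun r => (modeFlow μ a r p).1) (modeFlow μ a s p).2 s := by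
      have h' := (ContinuousLinearMap.fst ℝ ℝ ℝ).hasFDerivAt.comp_hasDerivAt s h
      exact h'.congr_deriv (by simp [modeGenerator])
    have h2 : HasDerivAt (fun r => (modeFlow μ a r p).2)
        (1 / μ * (-a * (modeFlow μ a s p).1 - (modeFlow μ a s p).2)) s := by
      have h' := (ContinuousLinearMap.snd ℝ ℝ ℝ).hasFDerivAt.comp_hasDerivAt s h
      exact h'.congr_deriv (by simp [modeGenerator])
    refine ((h1.pow 2).add ((h2.pow 2).const_mul (μ / a))).congr_deriv ?_
    field_simp
    ring
  change E t ≤ _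
  rw [← h0]
  rcases le_total 0 t with ht | ht
  · have hanti : Antitone E := antitone_of_hasDerivAt_nonpos hd (fun s => by
      have : 0 ≤ 2 / a * (modeFlow μ a s p).2 ^ 2 := by positivity
      simp only [Pi.zero_apply]
      linarith)
    have h1 : 1 ≤ Real.exp (2 * |t| / μ) := Real.one_le_exp (by positivity)
    nlinarith [hanti ht, hEn 0]
  · have hd2 : ∀ s, HasDerivAt (fun r => Real.exp (2 * r / μ) * E r)
        (Real.exp (2 * s / μ) * (2 / μ) * E s
          + Real.exp (2 * s / μ) * (-(2 / a) * (modeFlow μ a s p).2 ^ 2)) s := by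
      intro s
      have he : HasDerivAt (fun r : ℝ => Real.exp (2 * r / μ)) (Real.exp (2 * s / μ) * (2 / μ)) s := by
        have := (((hasDerivAt_id s).const_mul 2).div_const μ).exp
        simpa using this
      exact he.mul (hd s)
    have hmono : Monotone (fun r => Real.exp (2 * r / μ) * E r) :=
      monotone_of_hasDerivAt_nonneg hd2 (fun s => by
        have h3 : Real.exp (2 * s / μ) * (2 / μ) * E s
            + Real.exp (2 * s / μ) * (-(2 / a) * (modeFlow μ a s p).2 ^ 2)
            = Real.exp (2 * s / μ) * (2 / μ) * (modeFlow μ a s p).1 ^ 2 := by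
          simp only [hE]
          field_simp
          ring
        simp only [Pi.zero_apply]
        rw [h3]
        positivity)
    have h4 := hmono ht
    simp only [mul_zero, zero_div, Real.exp_zero, one_mul] at h4
    rw [abs_of_nonpos ht, show 2 * -t / μ = -(2 * t / μ) by ring, Real.exp_neg]
    rw [inv_mul_eq_div, le_div_iff₀ (Real.exp_pos _)]
    linarith

section Semigroup

variable (S : DirichletEigensystem D)

/-- The two coordinates of `z = (u, v) ∈ 𝓗` in the `k`-th mode. -/
def modeCoeff (z : PhaseSpace S) (k : ℕ) : ℝ × ℝ := (S.coeff z.fst k, z.snd.coeff k)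

theorem summable_modeCoeff (z : PhaseSpace S) (μ : ℝ) : Summable fun k =>
    (modeCoeff S z k).1 ^ 2 + μ / S.α k * (modeCoeff S z k).2 ^ 2 := by
  refine (S.summable_coeff_sq z.fst).add ((z.snd.summable.mul_left μ).congr (fun k => ?_))
  rw [Real.rpow_neg_one, modeCoeff]
  ring

theorem summable_flow_fst {μ : ℝ} (hμ : 0 < μ) (t : ℝ) (z : PhaseSpace S) :
    Summable fun k => (modeFlow μ (S.α k) t (modeCoeff S z k)).1 ^ 2 := by
  refine Summable.of_nonneg_of_le (fun k => sq_nonneg _) (fun k => ?_)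
    ((summable_modeCoeff S z μ).mul_left (Real.exp (2 * |t| / μ)))
  have h := modeFlow_energy hμ (S.pos k) t (modeCoeff S z k)
  have h2 : 0 ≤ μ / S.α k * (modeFlow μ (S.α k) t (modeCoeff S z k)).2 ^ 2 := by
    have := S.pos k
    positivity
  linarith

theorem summable_flow_snd {μ : ℝ} (hμ : 0 < μ) (t : ℝ) (z : PhaseSpace S) :
    Summable fun k =>
      S.α k ^ (-1 : ℝ) * (modeFlow μ (S.α k) t (modeCoeff S z k)).2 ^ 2 := by
  refine Summable.of_nonneg_of_le
    (fun k => mul_nonneg (Real.rpow_nonneg (S.pos k).le _) (sq_nonneg _)) (fun k => ?_)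
    (((summable_modeCoeff S z μ).mul_left (Real.exp (2 * |t| / μ))).mul_left μ⁻¹)
  have h := modeFlow_energy hμ (S.pos k) t (modeCoeff S z k)
  have h2 := sq_nonneg (modeFlow μ (S.α k) t (modeCoeff S z k)).1
  have h3 : S.α k ^ (-1 : ℝ) * (modeFlow μ (S.α k) t (modeCoeff S z k)).2 ^ 2
      = μ⁻¹ * (μ / S.α k * (modeFlow μ (S.α k) t (modeCoeff S z k)).2 ^ 2) := by
    rw [Real.rpow_neg_one]
    field_simp
  rw [h3]
  exact mul_le_mul_of_nonneg_left (by linarith) (inv_nonneg.2 hμ.le)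

/-- `S_μ(t)` on `𝓗`, as a linear map: the exponential of `t A_μ`, computed mode by mode (`A_μ` leaves
each of the two-dimensional spaces `ℝ eₖ × ℝ eₖ` invariant). -/
def semigroupLin {μ : ℝ} (hμ : 0 < μ) (t : ℝ) : PhaseSpace S →ₗ[ℝ] PhaseSpace S where
  toFun z := WithLp.toLp 2
    (S.ofCoeff (fun k => (modeFlow μ (S.α k) t (modeCoeff S z k)).1) (summable_flow_fst S hμ t z),
     HScale.mk (fun k => (modeFlow μ (S.α k) t (modeCoeff S z k)).2) (summable_flow_snd S hμ t z))
  map_add' z w := by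
    have h : ∀ k, modeCoeff S (z + w) k = modeCoeff S z k + modeCoeff S w k := fun k => by
      simp [modeCoeff, DirichletEigensystem.coeff]
    apply (WithLp.equiv 2 _).injective
    refine Prod.ext (S.ext_coeff fun k => ?_) (HScale.ext fun k => ?_)
    · have : ∀ a b : L2 D, S.coeff (a + b) k = S.coeff a k + S.coeff b k := fun a b => by
        simp [DirichletEigensystem.coeff]
      simp [h, this]
    · simp [h]
  map_smul' c z := by
    have h : ∀ k, modeCoeff S (c • z) k = c • modeCoeff S z k := fun k => by
      simp [modeCoeff, DirichletEigensystem.coeff]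
    apply (WithLp.equiv 2 _).injective
    refine Prod.ext (S.ext_coeff fun k => ?_) (HScale.ext fun k => ?_)
    · have : ∀ a : L2 D, S.coeff (c • a) k = c * S.coeff a k := fun a => by
        simp [DirichletEigensystem.coeff]
      simp [h, this]
    · simp [h]

theorem energy_eq_tsum (z : PhaseSpace S) (μ : ℝ) : ‖z.fst‖ ^ 2 + μ * ‖z.snd‖ ^ 2 =
    ∑' k, ((modeCoeff S z k).1 ^ 2 + μ / S.α k * (modeCoeff S z k).2 ^ 2) := by
  rw [S.norm_sq_eq_tsum, HScale.norm_sq, ← tsum_mul_left,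
    ← (S.summable_coeff_sq z.fst).tsum_add (z.snd.summable.mul_left μ)]
  refine tsum_congr fun k => ?_
  rw [Real.rpow_neg_one, modeCoeff]
  ring

theorem modeCoeff_semigroupLin {μ : ℝ} (hμ : 0 < μ) (t : ℝ) (z : PhaseSpace S) (k : ℕ) :
    modeCoeff S (semigroupLin S hμ t z) k = modeFlow μ (S.α k) t (modeCoeff S z k) := by
  refine Prod.ext ?_ ?_
  · simp [modeCoeff, semigroupLin]
  · simp [modeCoeff, semigroupLin]

theorem semigroupLin_energy {μ : ℝ} (hμ : 0 < μ) (t : ℝ) (z : PhaseSpace S) :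
    ‖(semigroupLin S hμ t z).fst‖ ^ 2 + μ * ‖(semigroupLin S hμ t z).snd‖ ^ 2 ≤
      Real.exp (2 * |t| / μ) * (‖z.fst‖ ^ 2 + μ * ‖z.snd‖ ^ 2) := by
  rw [energy_eq_tsum, energy_eq_tsum, ← tsum_mul_left]
  refine (summable_modeCoeff S _ μ).tsum_le_tsum (fun k => ?_)
    ((summable_modeCoeff S z μ).mul_left _)
  rw [modeCoeff_semigroupLin]
  exact modeFlow_energy hμ (S.pos k) t _

/-- The semigroup `S_μ(t)` of bounded operators on `𝓗` generated by
`A_μ (u, v) = (v, (A u - v) / μ)`. -/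
def semigroup {μ : ℝ} (hμ : 0 < μ) (t : ℝ) : PhaseSpace S →L[ℝ] PhaseSpace S :=
  (semigroupLin S hμ t).mkContinuous
    (Real.sqrt ((1 + μ⁻¹) * (Real.exp (2 * |t| / μ) * (1 + μ)))) (by
      intro z
      have hE := semigroupLin_energy S hμ t z
      set w := semigroupLin S hμ t z
      have hw : ‖w‖ ^ 2 ≤ (1 + μ⁻¹) * (‖w.fst‖ ^ 2 + μ * ‖w.snd‖ ^ 2) := by
        rw [WithLp.prod_norm_sq_eq_of_L2]
        have : (1 + μ⁻¹) * (‖w.fst‖ ^ 2 + μ * ‖w.snd‖ ^ 2)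
            = ‖w.fst‖ ^ 2 + ‖w.snd‖ ^ 2 + (μ⁻¹ * ‖w.fst‖ ^ 2 + μ * ‖w.snd‖ ^ 2) := by
          field_simp
          ring
        rw [this]
        have : 0 ≤ μ⁻¹ * ‖w.fst‖ ^ 2 + μ * ‖w.snd‖ ^ 2 := by positivity
        linarith
      have hz : ‖z.fst‖ ^ 2 + μ * ‖z.snd‖ ^ 2 ≤ (1 + μ) * ‖z‖ ^ 2 := by
        rw [WithLp.prod_norm_sq_eq_of_L2]
        nlinarith [mul_nonneg hμ.le (sq_nonneg ‖z.fst‖), sq_nonneg ‖z.snd‖]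
      have hfin : ‖w‖ ^ 2 ≤ ((1 + μ⁻¹) * (Real.exp (2 * |t| / μ) * (1 + μ))) * ‖z‖ ^ 2 := by
        refine hw.trans ?_
        rw [mul_assoc, mul_assoc]
        gcongr
        exact hE.trans (by gcongr)
      rw [← Real.sqrt_sq (norm_nonneg w), ← Real.sqrt_sq (norm_nonneg z),
        ← Real.sqrt_mul (by positivity)]
      exact Real.sqrt_le_sqrt hfin)

end Semigroup

/-! ### Assumptions on the data -/

/-- The growth `αₖ ∼ k^{2/d}` of the eigenvalues (here `αₖ` is numbered from `k = 0`). -/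
def DirichletEigensystem.HasWeylGrowth (S : DirichletEigensystem D) : Prop :=
  ∃ C : ℝ, 0 < C ∧ ∀ k : ℕ, C⁻¹ * ((k : ℝ) + 1) ^ (2 / (d : ℝ)) ≤ S.α k ∧
    S.α k ≤ C * ((k : ℝ) + 1) ^ (2 / (d : ℝ))

/-- `Q` is diagonal in the basis `eₖ`, with eigenvalues comparable to `αₖ^{-β}`. -/
def IsDiagonalOfOrder (S : DirichletEigensystem D) (β : ℝ) (Q : L2 D →L[ℝ] L2 D) : Prop :=
  ∃ lam : ℕ → ℝ, (∀ k, Q (S.e k) = lam k • S.e k) ∧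
    ∃ c : ℝ, 0 < c ∧ ∀ k, 1 / c * S.α k ^ (-β) ≤ lam k ∧ lam k ≤ c * S.α k ^ (-β)

/-- `u ∈ L²(D)` belongs to `H^δ` (meant for `δ ≥ 0`). -/
def MemScale (S : DirichletEigensystem D) (δ : ℝ) (u : L2 D) : Prop :=
  Summable fun k => S.α k ^ δ * S.coeff u k ^ 2

/-- The norm `|u|_{H^δ}` of `u ∈ L²(D) ∩ H^δ`. -/
def scaleNorm (S : DirichletEigensystem D) (δ : ℝ) (u : L2 D) : ℝ :=
  Real.sqrt (∑' k, S.α k ^ δ * S.coeff u k ^ 2)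

/-- `B(0) = 0` and, for each `δ ∈ [0, 1 + 2β]`, `B` maps `H^δ` into itself and is Lipschitz continuous
there, with Lipschitz constant less than the first eigenvalue of `-A`. -/
structure IsAdmissibleNonlinearity (S : DirichletEigensystem D) (β : ℝ) (B : L2 D → L2 D) :
    Prop where
  map_zero : B 0 = 0
  maps : ∀ δ ∈ Icc (0 : ℝ) (1 + 2 * β), ∀ u, MemScale S δ u → MemScale S δ (B u)
  lipschitz : ∀ δ ∈ Icc (0 : ℝ) (1 + 2 * β), ∃ γ < S.α 0, ∀ u v,
    MemScale S δ u → MemScale S δ v → scaleNorm S δ (B u - B v) ≤ γ * scaleNorm S δ (u - v)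

/-! ### The skeleton equation and the action functional -/

section Skeleton

variable (S : DirichletEigensystem D) (Q : L2 D →L[ℝ] L2 D) (B : L2 D → L2 D)

/-- `B_μ (u, v) = (0, B(u)) / μ`. -/
def nonlinearityLift (μ : ℝ) (z : PhaseSpace S) : PhaseSpace S :=
  (1 / μ) • WithLp.toLp 2 (0, inclusion S (B z.fst))

/-- `Q_μ h = (0, Q h) / μ`. -/
def noiseLift (μ : ℝ) (h : L2 D) : PhaseSpace S :=
  (1 / μ) • WithLp.toLp 2 (0, inclusion S (Q h))

/-- `z` is, on `[t₁, t₂]`, a mild solution of `dz/dt = A_μ z + B_μ(z) + Q_μ ψ` (with initial value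
`z(t₁)`). -/
def IsMildSolution {μ : ℝ} (hμ : 0 < μ) (t₁ t₂ : ℝ) (ψ : ℝ → L2 D) (z : ℝ → PhaseSpace S) :
    Prop :=
  ∀ t ∈ Icc t₁ t₂, z t = semigroup S hμ (t - t₁) (z t₁) +
    ∫ s in t₁..t, semigroup S hμ (t - s) (nonlinearityLift S B μ (z s) + noiseLift S Q μ (ψ s))

/-- The action functional `I^μ_{t₁,t₂}(z) = ½ inf |ψ|²_{L²((t₁,t₂);H)}` over the controls `ψ` for which
`z` is a mild solution; it is `∞` if there is none. -/
def action {μ : ℝ} (hμ : 0 < μ) (t₁ t₂ : ℝ) (z : ℝ → PhaseSpace S) : ℝ≥0∞ :=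
  ⨅ (ψ : Lp (L2 D) 2 (volume.restrict (Ioo t₁ t₂))) (_ : IsMildSolution S Q B hμ t₁ t₂ ψ z),
    ENNReal.ofReal (1 / 2 * ‖ψ‖ ^ 2)

/-- `I^μ_{-∞}(z) = sup_{t > 0} I^μ_{-t,0}(z)` for a path on `(-∞, 0]`. -/
def halfLineAction {μ : ℝ} (hμ : 0 < μ) (z : C(Iic (0 : ℝ), PhaseSpace S)) : ℝ≥0∞ :=
  ⨆ (t : ℝ) (_ : 0 < t), action S Q B hμ (-t) 0 (IicExtend z)

/-- The level set `K^μ_{-∞}(r)` in `C((-∞, 0]; 𝓗)`. Mathlib's topology on `C(X, Y)` is the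
compact-open topology, which on `X = (-∞, 0]` is that of uniform convergence on bounded intervals. -/
def levelSet {μ : ℝ} (hμ : 0 < μ) (r : ℝ) : Set C(Iic (0 : ℝ), PhaseSpace S) :=
  {z | Tendsto (fun t => ‖z t‖) atBot (𝓝 0) ∧ halfLineAction S Q B hμ z ≤ ENNReal.ofReal r}

end Skeleton

end DampedWave

end

noncomputable section

open MeasureTheory Set Filter Topology
open scoped ENNReal ContDiff

namespace DampedWave

variable {d : ℕ} {D : Set (EuclideanSpace ℝ (Fin d))}

/-! The core is a linear bound for the state by the control alone. In the eigenbasis, the linear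
equation splits into damped oscillators `μ x'' + x' + a x = f` with `a ≥ α 0`. A Lyapunov function
with constants uniform in `a` shows that, for small `μ`, all modes decay at one rate `ν`, and that
an impulse `f` moves the position by at most `K e^{-νt}|f|`. The time integral `K / ν` of this
response can be brought so close to the static gain `1 / α 0` that `K * γ < ν`, where `γ < α 0` is
the Lipschitz constant of `B` on `L²(D)` (`exists_uniform_mode_decay`, `exists_uniformDecay`).

Take a bounded path on a half line, driven by controls of norm at most `ρ`. In the Duhamel formula
started at `t₁`, the initial term vanishes as `t₁ → -∞`. The position supremum `X` then satisfies `X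
≤ (K γ / ν) X + K q ρ` with a constant `q`, and the first term is absorbed on the left. So the whole
state is bounded by a constant times `ρ`, without reference to the a priori bound of the path
(`exists_norm_apply_le_of_isDriven`).

Compactness is then Arzelà–Ascoli. The same estimate applied to high-mode projections gains a factor
`(α m)^{-1/2}`, since the forcing lies in `L²(D)` while velocities are measured in `H⁻¹`. As `α m →
∞`, the values of all paths in a level set lie in one compact set, and strong continuity of the
semigroup on it gives a common modulus of continuity.

For closedness, the action is lower semicontinuous: controls converge weakly, paths converge
uniformly on bounded intervals, and the control enters linearly (`action_le_of_tendstoUniformlyOn`).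
The condition at `-∞` does not pass to such limits by itself. It is recovered from the action: by
superadditivity, the cost on `(-∞, T]` tends to zero as `T → -∞`, so the linear bound in `ρ` forces
the path to vanish there. -/

/-! ### Decay of a single mode -/

/-- The squared phase-space norm of a mode with eigenvalue `-a`. -/
def modeNormSq (a : ℝ) (p : ℝ × ℝ) : ℝ := p.1 ^ 2 + p.2 ^ 2 / a

/-- A Lyapunov function of the damped mode. -/
def modeLyapunov (μ ε a : ℝ) (p : ℝ × ℝ) : ℝ :=
  (p.1 + μ * p.2) ^ 2 + (1 + ε) * a * μ * p.1 ^ 2 + ε * μ ^ 2 * p.2 ^ 2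

theorem hasDerivAt_modeFlow_fst (μ a t : ℝ) (p : ℝ × ℝ) :
    HasDerivAt (fun r => (modeFlow μ a r p).1) (modeFlow μ a t p).2 t := by
  have h' := (ContinuousLinearMap.fst ℝ ℝ ℝ).hasFDerivAt.comp_hasDerivAt t
    (hasDerivAt_modeFlow μ a t p)
  exact h'.congr_deriv (by simp [modeGenerator])

theorem hasDerivAt_modeFlow_snd (μ a t : ℝ) (p : ℝ × ℝ) :
    HasDerivAt (fun r => (modeFlow μ a r p).2)
      (1 / μ * (-a * (modeFlow μ a t p).1 - (modeFlow μ a t p).2)) t := by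
  have h' := (ContinuousLinearMap.snd ℝ ℝ ℝ).hasFDerivAt.comp_hasDerivAt t
    (hasDerivAt_modeFlow μ a t p)
  exact h'.congr_deriv (by simp [modeGenerator])

/-- Along the flow the derivative of `x + μ y` is `-a x`. The coefficient `(1 + ε) a μ` is the one
for which all cross terms `x y` cancel, leaving a negative definite form. -/
theorem hasDerivAt_modeLyapunov {μ : ℝ} (hμ : 0 < μ) (ε a t : ℝ) (p : ℝ × ℝ) :
    HasDerivAt (fun r => modeLyapunov μ ε a (modeFlow μ a r p))
      (-2 * (a * (modeFlow μ a t p).1 ^ 2 + ε * μ * (modeFlow μ a t p).2 ^ 2)) t := by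
  have h1 := hasDerivAt_modeFlow_fst μ a t p
  have h2 := hasDerivAt_modeFlow_snd μ a t p
  have h := (((h1.add (h2.const_mul μ)).pow 2).add ((h1.pow 2).const_mul ((1 + ε) * a * μ))).add
    ((h2.pow 2).const_mul (ε * μ ^ 2))
  refine h.congr_deriv ?_
  simp only [Pi.add_apply]
  field_simp
  ring

/-- Young's inequality with weight `ε` on `(x + μ y)²` separates the variables; `h1` and `h2`
compare the coefficients of `x²` and `y²`. The dissipation thus dominates the Lyapunov function,
which therefore decays at rate `2ν`. -/
theorem modeLyapunov_le {μ ε a ν : ℝ} (hμ : 0 < μ) (hε : 0 < ε) (hν : 0 ≤ ν)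
    (h1 : ν * ((1 + ε) * (1 + a * μ)) ≤ a) (h2 : ν * μ * (1 + ε⁻¹ + ε) ≤ ε) (p : ℝ × ℝ) :
    ν * modeLyapunov μ ε a p ≤ a * p.1 ^ 2 + ε * μ * p.2 ^ 2 := by
  have hy : (p.1 + μ * p.2) ^ 2 ≤ (1 + ε) * p.1 ^ 2 + (1 + ε⁻¹) * (μ ^ 2 * p.2 ^ 2) := by
    have h3 : (1 + ε) * p.1 ^ 2 + (1 + ε⁻¹) * (μ ^ 2 * p.2 ^ 2) - (p.1 + μ * p.2) ^ 2
        = ε⁻¹ * (ε * p.1 - μ * p.2) ^ 2 := by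
      field_simp
      ring
    have h4 : 0 ≤ ε⁻¹ * (ε * p.1 - μ * p.2) ^ 2 := by positivity
    linarith
  have h5 := mul_le_mul_of_nonneg_left hy hν
  have h6 := mul_le_mul_of_nonneg_right h1 (sq_nonneg p.1)
  have h7 := mul_le_mul_of_nonneg_right h2 (mul_nonneg hμ.le (sq_nonneg p.2))
  unfold modeLyapunov
  linarith

theorem modeLyapunov_flow_le {μ ε a ν : ℝ} (hμ : 0 < μ) (hε : 0 < ε) (hν : 0 ≤ ν)
    (h1 : ν * ((1 + ε) * (1 + a * μ)) ≤ a) (h2 : ν * μ * (1 + ε⁻¹ + ε) ≤ ε) (p : ℝ × ℝ)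
    {t : ℝ} (ht : 0 ≤ t) :
    modeLyapunov μ ε a (modeFlow μ a t p) ≤ Real.exp (-(2 * ν * t)) * modeLyapunov μ ε a p := by
  have hd : ∀ s, HasDerivAt
      (fun r => Real.exp (2 * ν * r) * modeLyapunov μ ε a (modeFlow μ a r p))
      (Real.exp (2 * ν * s) * (2 * ν) * modeLyapunov μ ε a (modeFlow μ a s p) +
        Real.exp (2 * ν * s) *
        (-2 * (a * (modeFlow μ a s p).1 ^ 2 + ε * μ * (modeFlow μ a s p).2 ^ 2))) s := by
    intro s
    have he : HasDerivAt (fun r : ℝ => Real.exp (2 * ν * r))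
        (Real.exp (2 * ν * s) * (2 * ν)) s := by
      simpa using ((hasDerivAt_id s).const_mul (2 * ν)).exp
    exact he.mul (hasDerivAt_modeLyapunov hμ ε a s p)
  have hanti := antitone_of_hasDerivAt_nonpos hd (fun s => by
    have h3 := mul_le_mul_of_nonneg_left
      (modeLyapunov_le hμ hε hν h1 h2 (modeFlow μ a s p)) (Real.exp_pos (2 * ν * s)).le
    simp only [Pi.zero_apply]
    linarith)
  have h4 := hanti ht
  simp only [mul_zero, Real.exp_zero, one_mul, modeFlow_zero] at h4
  rw [Real.exp_neg, inv_mul_eq_div, le_div_iff₀ (Real.exp_pos _)]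
  linarith

/-- With `w = x + μ y`, the position solves `μ x' + x = w`, `x(0) = 0`. The Lyapunov function
dominates `w²` and starts at `(1 + ε) f²`, so `|w|` decays with a constant near `1`. Filtering `w`
through the kernel `e^{-t/μ}/μ` costs only the factor `1 / (1 - ν μ)`. Going through `w` keeps the
gain close to `1`, which the later absorption requires. -/
theorem abs_modeFlow_fst_le {μ ε a ν : ℝ} (hμ : 0 < μ) (hε : 0 < ε) (ha : 0 < a) (hν : 0 ≤ ν)
    (h1 : ν * ((1 + ε) * (1 + a * μ)) ≤ a) (h2 : ν * μ * (1 + ε⁻¹ + ε) ≤ ε) (h3 : ν * μ < 1)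
    (f : ℝ) {t : ℝ} (ht : 0 ≤ t) :
    |(modeFlow μ a t (0, f / μ)).1| ≤ (1 + ε) / (1 - ν * μ) * Real.exp (-(ν * t)) * |f| := by
  set p : ℝ × ℝ := (0, f / μ) with hp
  set K := (1 + ε) / (1 - ν * μ) with hK
  have h3' : 0 < 1 - ν * μ := by linarith
  have hK0 : 0 < K := by positivity
  have hw : ∀ s, 0 ≤ s → |(modeFlow μ a s p).1 + μ * (modeFlow μ a s p).2| ≤
      (1 + ε) * Real.exp (-(ν * s)) * |f| := by
    intro s hs
    have h4 := modeLyapunov_flow_le hμ hε hν h1 h2 p hs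
    refine abs_le_of_sq_le_sq ?_ (by positivity)
    have h5 : modeLyapunov μ ε a p = (1 + ε) * f ^ 2 := by
      simp only [modeLyapunov, hp]
      field_simp
      ring
    have h6 : ((modeFlow μ a s p).1 + μ * (modeFlow μ a s p).2) ^ 2 ≤
        modeLyapunov μ ε a (modeFlow μ a s p) := by
      have : 0 ≤ (1 + ε) * a * μ * (modeFlow μ a s p).1 ^ 2
        + ε * μ ^ 2 * (modeFlow μ a s p).2 ^ 2 := by positivity
      unfold modeLyapunov
      linarith
    have h7 : Real.exp (-(2 * ν * s)) = Real.exp (-(ν * s)) ^ 2 := by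
      rw [← Real.exp_nat_mul]
      ring_nf
    rw [h5, h7] at h4
    -- The constant obtained is `√(1 + ε)`; it is enlarged to `1 + ε` to avoid the root.
    have h8 : (1 + ε) ≤ (1 + ε) ^ 2 := by nlinarith
    calc _ ≤ _ := h6.trans h4
      _ = (1 + ε) * (Real.exp (-(ν * s)) ^ 2 * f ^ 2) := by ring
      _ ≤ (1 + ε) ^ 2 * (Real.exp (-(ν * s)) ^ 2 * f ^ 2) := by gcongr
      _ = _ := by rw [mul_pow, mul_pow, sq_abs]; ring
  -- The signs `σ = ±1` give the two halves of the absolute value. After multiplication by the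
  -- integrating factor `e^{t/μ}`, majorant minus solution is monotone and is nonnegative at time
  -- `0`.
  have key : ∀ σ : ℝ, |σ| = 1 → σ * (modeFlow μ a t p).1 ≤ K * Real.exp (-(ν * t)) * |f| := by
    intro σ hσ
    have hd : ∀ s, HasDerivAt (fun r => K * |f| * Real.exp ((1 / μ - ν) * r)
        - σ * (Real.exp (r / μ) * (modeFlow μ a r p).1))
        (K * |f| * (Real.exp ((1 / μ - ν) * s) * (1 / μ - ν)) -
          σ * (Real.exp (s / μ) * (1 / μ) * (modeFlow μ a s p).1
            + Real.exp (s / μ) * (modeFlow μ a s p).2)) s := by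
      intro s
      have e1 : HasDerivAt (fun r : ℝ => Real.exp ((1 / μ - ν) * r))
          (Real.exp ((1 / μ - ν) * s) * (1 / μ - ν)) s := by
        simpa using ((hasDerivAt_id s).const_mul (1 / μ - ν)).exp
      have e2 : HasDerivAt (fun r : ℝ => Real.exp (r / μ)) (Real.exp (s / μ) * (1 / μ)) s := by
        simpa using ((hasDerivAt_id s).div_const μ).exp
      exact (e1.const_mul _).sub ((e2.mul (hasDerivAt_modeFlow_fst μ a s p)).const_mul σ)
    have hmono := monotoneOn_of_deriv_nonneg (convex_Ici (0 : ℝ))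
      (fun s _ => (hd s).continuousAt.continuousWithinAt)
      (fun s _ => (hd s).differentiableAt.differentiableWithinAt) (fun s hs => by
        rw [interior_Ici] at hs
        rw [(hd s).deriv]
        have e3 : Real.exp ((1 / μ - ν) * s) = Real.exp (s / μ) * Real.exp (-(ν * s)) := by
          rw [← Real.exp_add]
          ring_nf
        have e4 : σ * ((modeFlow μ a s p).1 + μ * (modeFlow μ a s p).2) ≤
            (1 + ε) * Real.exp (-(ν * s)) * |f| := by
          refine (le_abs_self _).trans ?_
          rw [abs_mul, hσ, one_mul]
          exact hw s (le_of_lt hs)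
        have e5 : K * (1 / μ - ν) = (1 + ε) / μ := by
          rw [hK]
          field_simp
        have e6 := mul_le_mul_of_nonneg_left e4
          (mul_nonneg (Real.exp_pos (s / μ)).le (one_div_pos.2 hμ).le)
        rw [e3]
        have e7 : K * |f| * (Real.exp (s / μ) * Real.exp (-(ν * s)) * (1 / μ - ν))
          = (K * (1 / μ - ν)) * |f| * (Real.exp (s / μ) * Real.exp (-(ν * s))) := by ring
        rw [e7, e5]
        have e8 : Real.exp (s / μ) * (1 / μ) * (σ * ((modeFlow μ a s p).1 +
          μ * (modeFlow μ a s p).2)) = σ * (Real.exp (s / μ) * (1 / μ) * (modeFlow μ a s p).1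
            + Real.exp (s / μ) * (modeFlow μ a s p).2) := by
          field_simp
        rw [e8] at e6
        have e9 : Real.exp (s / μ) * (1 / μ) * ((1 + ε) * Real.exp (-(ν * s)) * |f|)
          = (1 + ε) / μ * |f| * (Real.exp (s / μ) * Real.exp (-(ν * s))) := by
          field_simp
        linarith)
    have h9 := hmono (mem_Ici.2 le_rfl) (mem_Ici.2 ht) ht
    simp only [mul_zero, Real.exp_zero, zero_div, modeFlow_zero, hp, mul_one,
      sub_zero] at h9
    rw [← hp] at h9
    have h10 : 0 ≤ K * |f| := by positivity
    have h11 : Real.exp ((1 / μ - ν) * t) = Real.exp (t / μ) * Real.exp (-(ν * t)) := by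
      rw [← Real.exp_add]
      ring_nf
    rw [h11] at h9
    refine le_of_mul_le_mul_left ?_ (Real.exp_pos (t / μ))
    linarith
  rw [abs_le]
  have k1 := key 1 (by simp)
  have k2 := key (-1) (by simp)
  constructor <;> linarith

/-- The Lyapunov function is comparable to `a * modeNormSq a` with constants depending on `μ`, `ε`,
`a₀` but not on `a`, so its decay transfers to the norm uniformly over the modes. -/
theorem modeNormSq_flow_le {μ ε a a₀ ν : ℝ} (hμ : 0 < μ) (hε : 0 < ε) (ha₀ : 0 < a₀)
    (ha : a₀ ≤ a) (hν : 0 ≤ ν)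
    (h1 : ν * ((1 + ε) * (1 + a * μ)) ≤ a) (h2 : ν * μ * (1 + ε⁻¹ + ε) ≤ ε) (p : ℝ × ℝ)
    {t : ℝ} (ht : 0 ≤ t) :
    modeNormSq a (modeFlow μ a t p) ≤
      ((μ⁻¹ + (ε * μ ^ 2)⁻¹) * (2 / a₀ + (1 + ε) * μ + (2 + ε) * μ ^ 2)) *
        Real.exp (-(2 * ν * t)) * modeNormSq a p := by
  have ha' : 0 < a := ha₀.trans_le ha
  have upper : ∀ q : ℝ × ℝ, modeLyapunov μ ε a q ≤
      (2 / a₀ + (1 + ε) * μ + (2 + ε) * μ ^ 2) * (a * modeNormSq a q) := by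
    intro q
    have e1 : a * modeNormSq a q = a * q.1 ^ 2 + q.2 ^ 2 := by
      unfold modeNormSq
      field_simp
    have e2 : q.1 ^ 2 ≤ a * q.1 ^ 2 / a₀ := by
      rw [le_div_iff₀ ha₀]
      nlinarith [sq_nonneg q.1]
    have e3 : 0 ≤ 2 / a₀ * q.2 ^ 2 + (1 + ε) * μ * q.2 ^ 2 + (2 + ε) * μ ^ 2 * (a * q.1 ^ 2) := by
      positivity
    have e4 : (q.1 + μ * q.2) ^ 2 ≤ 2 * q.1 ^ 2 + 2 * (μ ^ 2 * q.2 ^ 2) := by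
      nlinarith [sq_nonneg (q.1 - μ * q.2)]
    rw [e1]
    unfold modeLyapunov
    have e5 : 2 / a₀ * (a * q.1 ^ 2) = 2 * (a * q.1 ^ 2 / a₀) := by ring
    nlinarith
  have lower : ∀ q : ℝ × ℝ, a * modeNormSq a q ≤
      (μ⁻¹ + (ε * μ ^ 2)⁻¹) * modeLyapunov μ ε a q := by
    intro q
    have e1 : a * modeNormSq a q = μ⁻¹ * (a * μ * q.1 ^ 2) +
        (ε * μ ^ 2)⁻¹ * (ε * μ ^ 2 * q.2 ^ 2) := by
      unfold modeNormSq
      field_simp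
    have e2 : a * μ * q.1 ^ 2 ≤ modeLyapunov μ ε a q := by
      have : 0 ≤ (q.1 + μ * q.2) ^ 2 + ε * a * μ * q.1 ^ 2 + ε * μ ^ 2 * q.2 ^ 2 := by positivity
      unfold modeLyapunov
      linarith
    have e3 : ε * μ ^ 2 * q.2 ^ 2 ≤ modeLyapunov μ ε a q := by
      have : 0 ≤ (q.1 + μ * q.2) ^ 2 + (1 + ε) * a * μ * q.1 ^ 2 := by positivity
      unfold modeLyapunov
      linarith
    rw [e1, add_mul]
    gcongr
  refine le_of_mul_le_mul_left ?_ ha'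
  calc _ ≤ _ := lower _
    _ ≤ (μ⁻¹ + (ε * μ ^ 2)⁻¹) * (Real.exp (-(2 * ν * t)) *
        ((2 / a₀ + (1 + ε) * μ + (2 + ε) * μ ^ 2) * (a * modeNormSq a p))) := by
      gcongr
      exact (modeLyapunov_flow_le hμ hε hν h1 h2 p ht).trans (by gcongr; exact upper p)
    _ = _ := by ring

/-- For small mass `μ` all modes with eigenvalues at least `a₀` decay at a common rate `ν`, and the
gain `K / ν` from forcing to position is smaller than `1 / γ` whenever `γ < a₀`. -/
theorem exists_uniform_mode_decay {a₀ γ : ℝ} (ha₀ : 0 < a₀) (hγ0 : 0 ≤ γ) (hγ : γ < a₀) :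
    ∃ μ₀ : ℝ, 0 < μ₀ ∧ ∀ μ, 0 < μ → μ ≤ μ₀ → ∃ ν K M : ℝ, 0 < ν ∧ 0 < K ∧ 0 < M ∧ K * γ < ν ∧
      ∀ a, a₀ ≤ a → ∀ t, 0 ≤ t →
        (∀ f, |(modeFlow μ a t (0, f / μ)).1| ≤ K * Real.exp (-(ν * t)) * |f|) ∧
        ∀ p, modeNormSq a (modeFlow μ a t p) ≤ M ^ 2 * Real.exp (-(2 * ν * t)) * modeNormSq a p := by
  -- At `ε = 0` the inequality reads `γ < a₀`, so by continuity it survives for small `ε > 0`. Its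
  -- two sides will bound `K * γ` from above and `ν` from below.
  obtain ⟨ε, hε, hε1, hεγ⟩ : ∃ ε : ℝ, 0 < ε ∧ ε < 1 ∧
      (1 + ε) / (1 - ε) * γ < a₀ / ((1 + ε) * (1 + ε)) := by
    have hc : Tendsto (fun ε : ℝ => a₀ / ((1 + ε) * (1 + ε)) - (1 + ε) / (1 - ε) * γ) (𝓝 0)
        (𝓝 (a₀ / ((1 + 0) * (1 + 0)) - (1 + 0) / (1 - 0) * γ)) := by
      apply ContinuousAt.tendsto (f := fun ε : ℝ =>
        a₀ / ((1 + ε) * (1 + ε)) - (1 + ε) / (1 - ε) * γ)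
      fun_prop (disch := norm_num)
    have h1 := hc.eventually (lt_mem_nhds (show (0 : ℝ) < _ by norm_num; exact hγ))
    have h2 : ∀ᶠ ε in 𝓝[>] (0 : ℝ), 0 < ε ∧ ε < 1 ∧
        0 < a₀ / ((1 + ε) * (1 + ε)) - (1 + ε) / (1 - ε) * γ := by
      filter_upwards [self_mem_nhdsWithin, nhdsWithin_le_nhds h1,
        nhdsWithin_le_nhds (gt_mem_nhds (zero_lt_one' ℝ))] with ε e1 e2 e3 using ⟨e1, e3, e2⟩
    obtain ⟨ε, e1, e2, e3⟩ := h2.exists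
    exact ⟨ε, e1, e2, by linarith⟩
  -- This makes `a₀ μ ≤ ε² / 3`, which yields both `ν μ (1 + ε⁻¹ + ε) ≤ ε` and `a₀ μ ≤ ε`.
  refine ⟨ε ^ 2 / (3 * a₀), by positivity, fun μ hμ hμ0 => ?_⟩
  have haμ : a₀ * μ ≤ ε ^ 2 / 3 := by
    rw [le_div_iff₀ (by positivity)] at hμ0
    linarith
  have haμ' : a₀ * μ ≤ ε := by nlinarith
  -- The largest rate allowed by the `x²` condition at `a = a₀`; larger `a` satisfy it too because
  -- `a / (1 + a μ)` increases with `a`.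
  set ν := a₀ / ((1 + ε) * (1 + a₀ * μ)) with hν
  have hν0 : 0 < ν := by positivity
  have hνa : ν ≤ a₀ := by
    rw [hν, div_le_iff₀ (by positivity)]
    have : 0 ≤ a₀ * (ε + a₀ * μ + ε * (a₀ * μ)) := by positivity
    linarith
  have hνμ : ν * μ ≤ a₀ * μ := by gcongr
  have hνμ1 : ν * μ < 1 := by linarith
  have hd : 0 < 1 - ν * μ := by linarith
  have h2 : ν * μ * (1 + ε⁻¹ + ε) ≤ ε := by
    have e1 : ν * μ * (1 + ε⁻¹ + ε) ≤ ε ^ 2 / 3 * (1 + ε⁻¹ + ε) := by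
      gcongr
      linarith
    have e3 : ε ^ 2 / 3 * (1 + ε⁻¹ + ε) = ε * ((ε + 1 + ε ^ 2) / 3) := by
      field_simp
    have e4 : (ε + 1 + ε ^ 2) / 3 ≤ 1 := by nlinarith
    have e5 := mul_le_mul_of_nonneg_left e4 hε.le
    linarith
  have h1 : ∀ a, a₀ ≤ a → ν * ((1 + ε) * (1 + a * μ)) ≤ a := by
    intro a ha
    rw [hν, div_mul_eq_mul_div, div_le_iff₀ (by positivity)]
    have : 0 ≤ (1 + ε) * (a - a₀) := mul_nonneg (by positivity) (by linarith)
    linarith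
  set M2 := (μ⁻¹ + (ε * μ ^ 2)⁻¹) * (2 / a₀ + (1 + ε) * μ + (2 + ε) * μ ^ 2) with hM2
  have hM2p : 0 < M2 := by positivity
  refine ⟨ν, (1 + ε) / (1 - ν * μ), √M2, hν0, by positivity, Real.sqrt_pos.2 hM2p, ?_,
    fun a ha t ht => ⟨fun f => abs_modeFlow_fst_le hμ hε (ha₀.trans_le ha) hν0.le (h1 a ha) h2
      hνμ1 f ht, fun p => ?_⟩⟩
  · calc (1 + ε) / (1 - ν * μ) * γ ≤ (1 + ε) / (1 - ε) * γ := by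
          gcongr
          · linarith
      _ < _ := hεγ
      _ ≤ ν := by
        rw [hν]
        gcongr
  · rw [Real.sq_sqrt hM2p.le]
    exact modeNormSq_flow_le hμ hε ha₀ ha hν0.le (h1 a ha) h2 p ht

/-! ### Coordinates in the phase space -/

section PhaseSpaceCoordinates

variable (S : DirichletEigensystem D)

theorem modeNormSq_nonneg {a : ℝ} (ha : 0 < a) (p : ℝ × ℝ) : 0 ≤ modeNormSq a p := by
  unfold modeNormSq
  positivity

theorem modeNormSq_sub_le {a : ℝ} (ha : 0 < a) (p q : ℝ × ℝ) :
    modeNormSq a (p - q) ≤ 2 * modeNormSq a p + 2 * modeNormSq a q := by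
  have h : 2 * modeNormSq a p + 2 * modeNormSq a q - modeNormSq a (p - q)
      = (p.1 + q.1) ^ 2 + (p.2 + q.2) ^ 2 / a := by
    simp only [modeNormSq, Prod.fst_sub, Prod.snd_sub]
    ring
  have h2 : 0 ≤ (p.1 + q.1) ^ 2 + (p.2 + q.2) ^ 2 / a := by positivity
  linarith

theorem summable_modeNormSq (z : PhaseSpace S) :
    Summable fun k => modeNormSq (S.α k) (modeCoeff S z k) :=
  (summable_modeCoeff S z 1).congr fun k => by
    unfold modeNormSq
    ring

theorem norm_sq_eq_tsum_modeNormSq (z : PhaseSpace S) :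
    ‖z‖ ^ 2 = ∑' k, modeNormSq (S.α k) (modeCoeff S z k) := by
  rw [WithLp.prod_norm_sq_eq_of_L2, ← one_mul (‖z.snd‖ ^ 2)]
  refine (energy_eq_tsum S z 1).trans (tsum_congr fun k => ?_)
  unfold modeNormSq
  ring

theorem modeNormSq_le_norm_sq (z : PhaseSpace S) (k : ℕ) :
    modeNormSq (S.α k) (modeCoeff S z k) ≤ ‖z‖ ^ 2 := by
  rw [norm_sq_eq_tsum_modeNormSq]
  exact (summable_modeNormSq S z).le_tsum k fun j _ => modeNormSq_nonneg (S.pos j) _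

theorem norm_le_of_modeNormSq_le {z : PhaseSpace S} {b : ℕ → ℝ} {R : ℝ} (hR : 0 ≤ R)
    (hb : HasSum b (R ^ 2)) (h : ∀ k, modeNormSq (S.α k) (modeCoeff S z k) ≤ b k) : ‖z‖ ≤ R := by
  refine le_of_sq_le_sq ?_ hR
  rw [norm_sq_eq_tsum_modeNormSq, ← hb.tsum_eq]
  exact (summable_modeNormSq S z).tsum_le_tsum h hb.summable

theorem phaseSpace_ext {z w : PhaseSpace S} (h : ∀ k, modeCoeff S z k = modeCoeff S w k) :
    z = w := by
  apply (WithLp.equiv 2 _).injective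
  exact Prod.ext (S.ext_coeff fun k => congrArg Prod.fst (h k))
    (HScale.ext fun k => congrArg Prod.snd (h k))

theorem modeCoeff_add (z w : PhaseSpace S) (k : ℕ) :
    modeCoeff S (z + w) k = modeCoeff S z k + modeCoeff S w k := by
  simp [modeCoeff, DirichletEigensystem.coeff]

theorem modeCoeff_smul (c : ℝ) (z : PhaseSpace S) (k : ℕ) :
    modeCoeff S (c • z) k = c • modeCoeff S z k := by
  simp [modeCoeff, DirichletEigensystem.coeff]

/-- The coordinates in the `k`-th mode, as a continuous linear map. -/
def modeCoeffCLM (k : ℕ) : PhaseSpace S →L[ℝ] ℝ × ℝ :=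
  LinearMap.mkContinuous
    { toFun := fun z => modeCoeff S z k
      map_add' := fun z w => modeCoeff_add S z w k
      map_smul' := fun c z => modeCoeff_smul S c z k } (1 + S.α k) (by
    intro z
    have ha := S.pos k
    have h := modeNormSq_le_norm_sq S z k
    have h1 : 0 ≤ (modeCoeff S z k).2 ^ 2 / S.α k := by positivity
    have h2 : (modeCoeff S z k).2 ^ 2 / S.α k * S.α k = (modeCoeff S z k).2 ^ 2 := by
      field_simp
    have h3 := sq_nonneg (modeCoeff S z k).1
    have h4 : 0 ≤ S.α k * ‖z‖ ^ 2 := by positivity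
    unfold modeNormSq at h
    refine max_le ?_ ?_
    · refine abs_le_of_sq_le_sq ?_ (by positivity)
      have h5 : 0 ≤ S.α k ^ 2 * ‖z‖ ^ 2 := by positivity
      simp only [LinearMap.coe_mk, AddHom.coe_mk]
      nlinarith
    · refine abs_le_of_sq_le_sq ?_ (by positivity)
      have h5 : 0 ≤ S.α k ^ 2 * ‖z‖ ^ 2 := by positivity
      have h6 : (modeCoeff S z k).2 ^ 2 ≤ S.α k * ‖z‖ ^ 2 := by
        rw [← h2, mul_comm]
        gcongr
        linarith
      simp only [LinearMap.coe_mk, AddHom.coe_mk]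
      nlinarith [sq_nonneg ‖z‖])

@[simp] theorem modeCoeffCLM_apply (k : ℕ) (z : PhaseSpace S) :
    modeCoeffCLM S k z = modeCoeff S z k := rfl

theorem modeCoeff_sub (z w : PhaseSpace S) (k : ℕ) :
    modeCoeff S (z - w) k = modeCoeff S z k - modeCoeff S w k :=
  (modeCoeffCLM S k).map_sub z w

/-! ### The semigroup -/

theorem modeCoeff_semigroup {μ : ℝ} (hμ : 0 < μ) (t : ℝ) (z : PhaseSpace S) (k : ℕ) :
    modeCoeff S (semigroup S hμ t z) k = modeFlow μ (S.α k) t (modeCoeff S z k) :=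
  modeCoeff_semigroupLin S hμ t z k

theorem modeFlow_add (μ a s t : ℝ) (p : ℝ × ℝ) :
    modeFlow μ a (s + t) p = modeFlow μ a s (modeFlow μ a t p) := by
  have h : modeFlow μ a (s + t) = modeFlow μ a s * modeFlow μ a t := by
    let _ : NormedAlgebra ℚ (ℝ × ℝ →L[ℝ] ℝ × ℝ) := NormedAlgebra.restrictScalars ℚ ℝ _
    unfold modeFlow
    rw [add_smul]
    exact NormedSpace.exp_add_of_commute
      (((Commute.refl (modeGenerator μ a)).smul_left s).smul_right t)
  rw [h]
  rfl

theorem semigroup_add {μ : ℝ} (hμ : 0 < μ) (s t : ℝ) (z : PhaseSpace S) :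
    semigroup S hμ (s + t) z = semigroup S hμ s (semigroup S hμ t z) :=
  phaseSpace_ext S fun k => by simp only [modeCoeff_semigroup, modeFlow_add]

@[simp] theorem semigroup_zero {μ : ℝ} (hμ : 0 < μ) (z : PhaseSpace S) :
    semigroup S hμ 0 z = z :=
  phaseSpace_ext S fun k => by simp only [modeCoeff_semigroup, modeFlow_zero]

theorem norm_semigroup_le {μ : ℝ} (hμ : 0 < μ) (t : ℝ) (z : PhaseSpace S) :
    ‖semigroup S hμ t z‖ ≤ √((1 + μ⁻¹) * (Real.exp (2 * |t| / μ) * (1 + μ))) * ‖z‖ :=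
  ContinuousLinearMap.le_of_opNorm_le _ (LinearMap.mkContinuous_norm_le _ (by positivity) _) z

theorem continuous_modeFlow (μ a : ℝ) (p : ℝ × ℝ) : Continuous fun t => modeFlow μ a t p :=
  continuous_iff_continuousAt.2 fun t => (hasDerivAt_modeFlow μ a t p).continuousAt

theorem continuous_modeNormSq (a : ℝ) : Continuous (modeNormSq a) := by
  unfold modeNormSq
  fun_prop

/-- A crude growth bound, valid for times of either sign and without smallness of `μ`. Being uniform
in `a`, it provides the majorant in the proof of strong continuity. -/
theorem modeNormSq_flow_le_exp {μ a : ℝ} (hμ : 0 < μ) (ha : 0 < a) (t : ℝ) (p : ℝ × ℝ) :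
    modeNormSq a (modeFlow μ a t p) ≤
      (1 + μ⁻¹) * (Real.exp (2 * |t| / μ) * (1 + μ)) * modeNormSq a p := by
  have h := modeFlow_energy hμ ha t p
  have e1 : ∀ q : ℝ × ℝ, modeNormSq a q ≤ (1 + μ⁻¹) * (q.1 ^ 2 + μ / a * q.2 ^ 2) := by
    intro q
    have : (1 + μ⁻¹) * (q.1 ^ 2 + μ / a * q.2 ^ 2) =
        modeNormSq a q + (μ⁻¹ * q.1 ^ 2 + μ / a * q.2 ^ 2) := by
      unfold modeNormSq
      field_simp
      ring
    rw [this]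
    exact le_add_of_nonneg_right (by positivity)
  have e2 : p.1 ^ 2 + μ / a * p.2 ^ 2 ≤ (1 + μ) * modeNormSq a p := by
    have : (1 + μ) * modeNormSq a p =
        p.1 ^ 2 + μ / a * p.2 ^ 2 + (μ * p.1 ^ 2 + p.2 ^ 2 / a) := by
      unfold modeNormSq
      ring
    rw [this]
    exact le_add_of_nonneg_right (by positivity)
  calc _ ≤ _ := e1 _
    _ ≤ (1 + μ⁻¹) * (Real.exp (2 * |t| / μ) * ((1 + μ) * modeNormSq a p)) := by
      gcongr
      exact h.trans (by gcongr)
    _ = _ := by ring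

/-- Each mode is continuous in time, and near `t₀` the squared increments of the modes are dominated
by a multiple of the summable squared mode norms of `z`; dominated convergence for series applies.
-/
theorem continuous_semigroup_apply {μ : ℝ} (hμ : 0 < μ) (z : PhaseSpace S) :
    Continuous fun t => semigroup S hμ t z := by
  refine continuous_iff_continuousAt.2 fun t₀ => ?_
  have key : Tendsto (fun t => ‖semigroup S hμ t z - semigroup S hμ t₀ z‖ ^ 2) (𝓝 t₀)
      (𝓝 0) := by
    have h0 : (0 : ℝ) = ∑' k : ℕ, (0 : ℝ) := by simp
    rw [h0]
    simp_rw [norm_sq_eq_tsum_modeNormSq, modeCoeff_sub, modeCoeff_semigroup]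
    set C := 2 * ((1 + μ⁻¹) * (Real.exp (2 * (|t₀| + 1) / μ) * (1 + μ)))
      + 2 * ((1 + μ⁻¹) * (Real.exp (2 * |t₀| / μ) * (1 + μ))) with hC
    refine tendsto_tsum_of_dominated_convergence ((summable_modeNormSq S z).mul_left C)
      (fun k => ?_) ?_
    · have hc : Continuous fun t => modeNormSq (S.α k) (modeFlow μ (S.α k) t (modeCoeff S z k) -
          modeFlow μ (S.α k) t₀ (modeCoeff S z k)) :=
        (continuous_modeNormSq _).comp ((continuous_modeFlow _ _ _).sub continuous_const)
      have := hc.tendsto t₀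
      simpa [modeNormSq] using this
    · filter_upwards [Metric.ball_mem_nhds t₀ one_pos] with t ht k
      have hk := S.pos k
      rw [Real.norm_of_nonneg (modeNormSq_nonneg hk _)]
      have ht' : |t| ≤ |t₀| + 1 := by
        have h1 := abs_sub_abs_le_abs_sub t t₀
        have h2 : |t - t₀| < 1 := by simpa [Real.dist_eq] using ht
        linarith
      refine (modeNormSq_sub_le hk _ _).trans ?_
      have e1 : modeNormSq (S.α k) (modeFlow μ (S.α k) t (modeCoeff S z k)) ≤
          (1 + μ⁻¹) * (Real.exp (2 * (|t₀| + 1) / μ) * (1 + μ)) *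
            modeNormSq (S.α k) (modeCoeff S z k) := by
        refine (modeNormSq_flow_le_exp hμ hk t _).trans ?_
        have := modeNormSq_nonneg hk (modeCoeff S z k)
        gcongr
      have e2 := modeNormSq_flow_le_exp hμ hk t₀ (modeCoeff S z k)
      rw [hC]
      linarith
  have h2 := (Real.continuous_sqrt.tendsto 0).comp key
  rw [Real.sqrt_zero] at h2
  refine tendsto_iff_norm_sub_tendsto_zero.2 (h2.congr fun t => ?_)
  simp [Real.sqrt_sq]

/-- Joint continuity follows from strong continuity and operator norms bounded locally in time. -/
theorem continuous_semigroup {μ : ℝ} (hμ : 0 < μ) :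
    Continuous fun p : ℝ × PhaseSpace S => semigroup S hμ p.1 p.2 := by
  refine continuous_iff_continuousAt.2 fun ⟨t₀, z₀⟩ => ?_
  rw [ContinuousAt, tendsto_iff_norm_sub_tendsto_zero]
  have hb : Tendsto (fun p : ℝ × PhaseSpace S =>
      √((1 + μ⁻¹) * (Real.exp (2 * |p.1| / μ) * (1 + μ))) * ‖p.2 - z₀‖
        + ‖semigroup S hμ p.1 z₀ - semigroup S hμ t₀ z₀‖) (𝓝 (t₀, z₀)) (𝓝 0) := by
    have hc : Continuous (fun p : ℝ × PhaseSpace S =>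
      √((1 + μ⁻¹) * (Real.exp (2 * |p.1| / μ) * (1 + μ))) * ‖p.2 - z₀‖
        + ‖semigroup S hμ p.1 z₀ - semigroup S hμ t₀ z₀‖) := by
      have := (continuous_semigroup_apply S hμ z₀).comp
        (continuous_fst (X := ℝ) (Y := PhaseSpace S))
      simp only [Function.comp_def] at this
      fun_prop
    have := hc.tendsto (t₀, z₀)
    simpa using this
  refine squeeze_zero (fun p => norm_nonneg _) (fun p => ?_) hb
  have h : semigroup S hμ p.1 p.2 - semigroup S hμ t₀ z₀ =
      semigroup S hμ p.1 (p.2 - z₀) + (semigroup S hμ p.1 z₀ - semigroup S hμ t₀ z₀) := by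
    rw [map_sub]
    abel
  rw [h]
  exact (norm_add_le _ _).trans (by gcongr; exact norm_semigroup_le S hμ _ _)

/-! ### Forcing -/

theorem norm_inclusion_le (u : L2 D) : ‖inclusion S u‖ ≤ √(S.α 0)⁻¹ * ‖u‖ := by
  have h0 := S.first_pos
  refine le_of_sq_le_sq ?_ (by positivity)
  rw [mul_pow, Real.sq_sqrt (by positivity), HScale.norm_sq, S.norm_sq_eq_tsum, ← tsum_mul_left]
  refine (inclusion S u).summable.tsum_le_tsum (fun k => ?_)
    ((S.summable_coeff_sq u).mul_left _)
  change S.α k ^ (-1 : ℝ) * S.coeff u k ^ 2 ≤ _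
  rw [Real.rpow_neg_one]
  gcongr
  exact S.mono (Nat.zero_le k)

/-- `f ↦ (0, f) / μ`. -/
def forcingLift (μ : ℝ) : L2 D →L[ℝ] PhaseSpace S :=
  LinearMap.mkContinuous
    { toFun := fun f => (1 / μ) • WithLp.toLp 2 (0, inclusion S f)
      map_add' := fun f g => by
        rw [map_add, ← smul_add, ← WithLp.toLp_add, Prod.mk_add_mk, add_zero]
      map_smul' := fun c f => by
        rw [map_smul, RingHom.id_apply, smul_comm c, ← WithLp.toLp_smul 2 c, Prod.smul_mk, smul_zero] }
    (|1 / μ| * √(S.α 0)⁻¹) (by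
    intro f
    simp only [LinearMap.coe_mk, AddHom.coe_mk, norm_smul, Real.norm_eq_abs, mul_assoc]
    gcongr
    refine le_trans (le_of_eq ?_) (norm_inclusion_le S f)
    refine (sq_eq_sq₀ (norm_nonneg _) (norm_nonneg _)).1 ?_
    rw [WithLp.prod_norm_sq_eq_of_L2]
    simp)

theorem nonlinearityLift_eq (B : L2 D → L2 D) (μ : ℝ) (z : PhaseSpace S) :
    nonlinearityLift S B μ z = forcingLift S μ (B z.fst) := rfl

theorem noiseLift_eq (Q : L2 D →L[ℝ] L2 D) (μ : ℝ) (h : L2 D) :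
    noiseLift S Q μ h = forcingLift S μ (Q h) := rfl

theorem modeCoeff_forcingLift (μ : ℝ) (f : L2 D) (k : ℕ) :
    modeCoeff S (forcingLift S μ f) k = (0, S.coeff f k / μ) := by
  have h : forcingLift S μ f = (1 / μ) • WithLp.toLp 2 ((0 : L2 D), inclusion S f) := rfl
  rw [h, modeCoeff_smul]
  refine Prod.ext ?_ ?_
  · simp [modeCoeff, DirichletEigensystem.coeff]
  · simp only [modeCoeff, Prod.smul_mk, smul_eq_mul]
    change 1 / μ * S.coeff f k = _
    ring

/-! ### Tails -/

/-- The element of the phase space with coordinates `p` in the `k`-th mode and zero elsewhere. -/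
def modeEmbed (k : ℕ) : ℝ × ℝ →L[ℝ] PhaseSpace S :=
  LinearMap.toContinuousLinearMap
    { toFun := fun p => WithLp.toLp 2
        (S.ofCoeff (fun j => if j = k then p.1 else 0)
          (summable_of_hasFiniteSupport ((Set.finite_singleton k).subset fun j hj => by
            by_contra h
            simp_all)),
         HScale.mk (fun j => if j = k then p.2 else 0)
          (summable_of_hasFiniteSupport ((Set.finite_singleton k).subset fun j hj => by
            by_contra h
            simp_all)))
      map_add' := fun p q => phaseSpace_ext S fun j => by
        rw [modeCoeff_add]
        refine Prod.ext ?_ ?_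
        · by_cases h : j = k <;> simp [modeCoeff, h]
        · by_cases h : j = k <;> simp [modeCoeff, h]
      map_smul' := fun c p => phaseSpace_ext S fun j => by
        rw [modeCoeff_smul]
        refine Prod.ext ?_ ?_
        · by_cases h : j = k <;> simp [modeCoeff, h]
        · by_cases h : j = k <;> simp [modeCoeff, h] }

theorem modeCoeff_modeEmbed (k j : ℕ) (p : ℝ × ℝ) :
    modeCoeff S (modeEmbed S k p) j = if j = k then p else 0 := by
  refine Prod.ext ?_ ?_
  · by_cases h : j = k <;> simp [modeCoeff, modeEmbed, h]
  · by_cases h : j = k <;> simp [modeCoeff, modeEmbed, h]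

/-- The projection onto the first `m` modes. -/
def headProj (m : ℕ) : PhaseSpace S →L[ℝ] PhaseSpace S :=
  ∑ k ∈ Finset.range m, (modeEmbed S k).comp (modeCoeffCLM S k)

/-- The projection onto the modes with index at least `m`. -/
def tailProj (m : ℕ) : PhaseSpace S →L[ℝ] PhaseSpace S :=
  ContinuousLinearMap.id ℝ _ - headProj S m

theorem modeCoeff_tailProj (m : ℕ) (z : PhaseSpace S) (j : ℕ) :
    modeCoeff S (tailProj S m z) j = if j < m then 0 else modeCoeff S z j := by
  have h : modeCoeff S (headProj S m z) j = if j < m then modeCoeff S z j else 0 := by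
    rw [← modeCoeffCLM_apply, headProj, sum_apply, map_sum]
    simp [modeCoeff_modeEmbed]
  rw [tailProj, sub_apply, modeCoeff_sub, h]
  by_cases hj : j < m <;> simp [hj]

/-- The projection factors through the finite-dimensional space `Fin m → ℝ × ℝ`, where bounded sets
are relatively compact. -/
theorem totallyBounded_image_headProj {s : Set (PhaseSpace S)}
    (hs : Bornology.IsBounded s) (m : ℕ) : TotallyBounded (headProj S m '' s) := by
  let J : (Fin m → ℝ × ℝ) →L[ℝ] PhaseSpace S :=
    ∑ k : Fin m, (modeEmbed S k).comp (ContinuousLinearMap.proj k)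
  let C : PhaseSpace S →L[ℝ] (Fin m → ℝ × ℝ) :=
    ContinuousLinearMap.pi fun k => modeCoeffCLM S k
  have h : ∀ z, headProj S m z = J (C z) := fun z => by
    simp [J, C, headProj, Finset.sum_range]
  have h2 : headProj S m '' s = J '' (C '' s) := by
    rw [image_image]
    exact image_congr fun z _ => h z
  rw [h2]
  exact (TotallyBounded.subset subset_closure
    (C.lipschitz.isBounded_image hs).isCompact_closure.totallyBounded).image J.uniformContinuous

/-- A bounded set with uniformly small tails is totally bounded. -/
theorem totallyBounded_of_tailProj {s : Set (PhaseSpace S)} (hs : Bornology.IsBounded s)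
    (h : ∀ ε > 0, ∃ m, ∀ z ∈ s, ‖tailProj S m z‖ ≤ ε) : TotallyBounded s := by
  refine Metric.totallyBounded_iff.2 fun ε hε => ?_
  obtain ⟨m, hm⟩ := h (ε / 2) (half_pos hε)
  obtain ⟨t, ht, hcov⟩ := Metric.totallyBounded_iff.1
    (totallyBounded_image_headProj S hs m) (ε / 2) (half_pos hε)
  refine ⟨t, ht, fun z hz => ?_⟩
  obtain ⟨y, hy, hzy⟩ := mem_iUnion₂.1 (hcov (mem_image_of_mem _ hz))
  refine mem_iUnion₂.2 ⟨y, hy, ?_⟩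
  rw [Metric.mem_ball, dist_eq_norm] at hzy ⊢
  have e : z - y = tailProj S m z + (headProj S m z - y) := by
    simp [tailProj]
  rw [e]
  linarith [norm_add_le (tailProj S m z) (headProj S m z - y), hm z hz]

/-! ### Uniform decay -/

/-- Exponential decay of the semigroup at rate `ν`, with gain `K` from a forcing to the position. -/
structure UniformDecay {μ : ℝ} (hμ : 0 < μ) (ν K M : ℝ) : Prop where
  rate_pos : 0 < ν
  gain_pos : 0 < K
  const_pos : 0 < M
  fst_le : ∀ t, 0 ≤ t → ∀ f, ‖(semigroup S hμ t (forcingLift S μ f)).fst‖ ≤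
    K * Real.exp (-(ν * t)) * ‖f‖
  norm_le : ∀ t, 0 ≤ t → ∀ z, ‖semigroup S hμ t z‖ ≤ M * Real.exp (-(ν * t)) * ‖z‖
  tail_le : ∀ m t, 0 ≤ t → ∀ f, ‖tailProj S m (semigroup S hμ t (forcingLift S μ f))‖ ≤
    M / (μ * √(S.α m)) * Real.exp (-(ν * t)) * ‖f‖

theorem exp_two_mul_eq_sq (ν t : ℝ) : Real.exp (-(2 * ν * t)) = Real.exp (-(ν * t)) ^ 2 := by
  rw [← Real.exp_nat_mul]
  ring_nf

/-- Parseval turns the uniform mode estimates into operator estimates. The strict inequality `K * γ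
< ν` is what smallness of `μ` buys. -/
theorem exists_uniformDecay {γ : ℝ} (hγ0 : 0 ≤ γ) (hγ : γ < S.α 0) :
    ∃ μ₀ : ℝ, 0 < μ₀ ∧ ∀ (μ : ℝ) (hμ : 0 < μ), μ ≤ μ₀ → ∃ ν K M : ℝ, K * γ < ν ∧
      UniformDecay S hμ ν K M := by
  obtain ⟨μ₀, hμ₀, h⟩ := exists_uniform_mode_decay S.first_pos hγ0 hγ
  refine ⟨μ₀, hμ₀, fun μ hμ hle => ?_⟩
  obtain ⟨ν, K, M, hν, hK, hM, hKγ, hdec⟩ := h μ hμ hle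
  refine ⟨ν, K, M, hKγ, hν, hK, hM, fun t ht f => ?_, fun t ht z => ?_, fun m t ht f => ?_⟩
  · refine le_of_sq_le_sq ?_ (by positivity)
    rw [mul_pow, S.norm_sq_eq_tsum, S.norm_sq_eq_tsum f, ← tsum_mul_left]
    refine (S.summable_coeff_sq _).tsum_le_tsum (fun k => ?_)
      ((S.summable_coeff_sq f).mul_left _)
    have e1 : S.coeff (semigroup S hμ t (forcingLift S μ f)).fst k =
        (modeFlow μ (S.α k) t (0, S.coeff f k / μ)).1 := by
      rw [← modeCoeff_forcingLift, ← modeCoeff_semigroup S hμ]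
      rfl
    have e2 := (hdec (S.α k) (S.mono (Nat.zero_le k)) t ht).1 (S.coeff f k)
    rw [e1, ← sq_abs, ← sq_abs (S.coeff f k), ← mul_pow]
    gcongr
  · refine norm_le_of_modeNormSq_le S (by positivity)
      (b := fun k => (M * Real.exp (-(ν * t))) ^ 2 * modeNormSq (S.α k) (modeCoeff S z k)) ?_
      (fun k => ?_)
    · rw [mul_pow _ ‖z‖, norm_sq_eq_tsum_modeNormSq]
      exact (summable_modeNormSq S z).hasSum.mul_left _
    · have e2 := (hdec (S.α k) (S.mono (Nat.zero_le k)) t ht).2 (modeCoeff S z k)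
      rw [modeCoeff_semigroup, mul_pow, ← exp_two_mul_eq_sq]
      exact e2
  · have hm := S.pos m
    refine norm_le_of_modeNormSq_le S (by positivity)
      (b := fun k => (M / (μ * √(S.α m)) * Real.exp (-(ν * t))) ^ 2 * S.coeff f k ^ 2) ?_
      (fun k => ?_)
    · rw [mul_pow _ ‖f‖, S.norm_sq_eq_tsum]
      exact (S.summable_coeff_sq f).hasSum.mul_left _
    · rw [modeCoeff_tailProj]
      split_ifs with hk
      · simp only [modeNormSq, Prod.fst_zero, Prod.snd_zero]
        simp only [ne_eq, OfNat.ofNat_ne_zero, not_false_eq_true, zero_pow, zero_div, add_zero]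
        positivity
      · have e2 := (hdec (S.α k) (S.mono (Nat.zero_le k)) t ht).2 (0, S.coeff f k / μ)
        rw [modeCoeff_semigroup, modeCoeff_forcingLift]
        refine e2.trans ?_
        -- The forcing has only a velocity component, weighted by `1 / α k ≤ 1 / α m` in `H⁻¹`: this
        -- is the source of the small tail factor.
        have e3 : modeNormSq (S.α k) (0, S.coeff f k / μ) ≤
            S.coeff f k ^ 2 / μ ^ 2 / S.α m := by
          simp only [modeNormSq, div_pow]
          rw [zero_pow two_ne_zero, zero_add]
          gcongr
          exact S.mono (not_lt.1 hk)
        calc _ ≤ M ^ 2 * Real.exp (-(2 * ν * t)) * (S.coeff f k ^ 2 / μ ^ 2 / S.α m) := by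
              gcongr
          _ = _ := by
            rw [exp_two_mul_eq_sq, mul_pow, div_pow, mul_pow, Real.sq_sqrt hm.le]
            field_simp

end PhaseSpaceCoordinates

/-! ### Variation of constants -/

section Duhamel

variable (S : DirichletEigensystem D)

theorem norm_tailProj_le (m : ℕ) (z : PhaseSpace S) : ‖tailProj S m z‖ ≤ ‖z‖ := by
  refine norm_le_of_modeNormSq_le S (norm_nonneg z)
    (b := fun k => modeNormSq (S.α k) (modeCoeff S z k)) ?_ (fun k => ?_)
  · rw [norm_sq_eq_tsum_modeNormSq]
    exact (summable_modeNormSq S z).hasSum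
  · rw [modeCoeff_tailProj]
    split_ifs
    · simpa [modeNormSq] using modeNormSq_nonneg (S.pos k) (modeCoeff S z k)
    · exact le_rfl

theorem norm_fst_le (x : PhaseSpace S) : ‖x.fst‖ ≤ ‖x‖ := by
  refine le_of_sq_le_sq ?_ (norm_nonneg x)
  rw [WithLp.prod_norm_sq_eq_of_L2]
  exact le_add_of_nonneg_right (sq_nonneg _)

theorem exists_norm_semigroup_le {μ : ℝ} (hμ : 0 < μ) (R : ℝ) :
    ∃ C : ℝ, 0 < C ∧ ∀ t, |t| ≤ R → ∀ z, ‖semigroup S hμ t z‖ ≤ C * ‖z‖ := by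
  refine ⟨√((1 + μ⁻¹) * (Real.exp (2 * R / μ) * (1 + μ))), by positivity, fun t ht z => ?_⟩
  refine (norm_semigroup_le S hμ t z).trans ?_
  gcongr

theorem aestronglyMeasurable_apply_sub {E : Type*} [TopologicalSpace E]
    [TopologicalSpace.PseudoMetrizableSpace E] {T : ℝ → E → E}
    (hT : Continuous fun p : ℝ × E => T p.1 p.2) (t : ℝ) {G : ℝ → E} {m : Measure ℝ}
    (hG : AEStronglyMeasurable G m) : AEStronglyMeasurable (fun s => T (t - s) (G s)) m := by
  have h : AEStronglyMeasurable (fun s : ℝ => t - s) m :=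
    (continuous_const.sub continuous_id).aestronglyMeasurable
  exact hT.comp_aestronglyMeasurable (h.prodMk hG)

theorem aestronglyMeasurable_semigroup_apply {μ : ℝ} (hμ : 0 < μ) (t : ℝ) {G : ℝ → PhaseSpace S}
    {m : Measure ℝ} (hG : AEStronglyMeasurable G m) :
    AEStronglyMeasurable (fun s => semigroup S hμ (t - s) (G s)) m :=
  aestronglyMeasurable_apply_sub (T := fun t z => semigroup S hμ t z)
    (continuous_semigroup S hμ) t hG

theorem intervalIntegrable_semigroup_apply {μ : ℝ} (hμ : 0 < μ) (t : ℝ) {a b : ℝ}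
    {G : ℝ → PhaseSpace S} (hG : IntervalIntegrable G volume a b) :
    IntervalIntegrable (fun s => semigroup S hμ (t - s) (G s)) volume a b := by
  obtain ⟨C, -, hC⟩ := exists_norm_semigroup_le S hμ (|t| + (|a| + |b|))
  rw [intervalIntegrable_iff] at hG ⊢
  refine Integrable.mono' (hG.norm.const_mul C)
    (aestronglyMeasurable_semigroup_apply S hμ t hG.aestronglyMeasurable) ?_
  refine (ae_restrict_mem measurableSet_uIoc).mono fun s hs => hC _ ?_ _
  have hs' : |s| ≤ |a| + |b| := by
    rcases mem_uIoc.1 hs with h | h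
    · exact abs_le.2 ⟨by linarith [neg_abs_le a, abs_nonneg b],
        by linarith [le_abs_self b, abs_nonneg a]⟩
    · exact abs_le.2 ⟨by linarith [neg_abs_le b, abs_nonneg a],
        by linarith [le_abs_self a, abs_nonneg b]⟩
  exact (abs_sub _ _).trans (by gcongr)

/-- The solution at time `b` is obtained by restarting the equation at an intermediate time `a`. -/
theorem duhamel_restart {μ : ℝ} (hμ : 0 < μ) {t₁ a b : ℝ} (x : PhaseSpace S)
    {G : ℝ → PhaseSpace S} (h1 : IntervalIntegrable G volume t₁ a)
    (h2 : IntervalIntegrable G volume a b) :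
    semigroup S hμ (b - t₁) x + ∫ s in t₁..b, semigroup S hμ (b - s) (G s) =
      semigroup S hμ (b - a) (semigroup S hμ (a - t₁) x +
        ∫ s in t₁..a, semigroup S hμ (a - s) (G s)) +
      ∫ s in a..b, semigroup S hμ (b - s) (G s) := by
  have e1 : ∀ s y, semigroup S hμ (b - s) y =
      semigroup S hμ (b - a) (semigroup S hμ (a - s) y) := fun s y => by
    rw [← semigroup_add]
    congr 2
    ring
  have e2 := intervalIntegral.integral_add_adjacent_intervals
    (intervalIntegrable_semigroup_apply S hμ b h1) (intervalIntegrable_semigroup_apply S hμ b h2)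
  have e3 := (semigroup S hμ (b - a)).intervalIntegral_comp_comm
    (intervalIntegrable_semigroup_apply S hμ a h1)
  rw [map_add, ← e3, ← e2, e1 t₁]
  simp_rw [← e1]
  abel

/-- Minkowski's inequality for a Duhamel integral. -/
theorem norm_duhamel_le {μ : ℝ} (hμ : 0 < μ) {a b c ν : ℝ} (hab : a ≤ b)
    {E : Type} [NormedAddCommGroup E] [NormedSpace ℝ E] [CompleteSpace E]
    (L : PhaseSpace S →L[ℝ] E)
    (hL : ∀ t, 0 ≤ t → ∀ f, ‖L (semigroup S hμ t (forcingLift S μ f))‖ ≤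
      c * Real.exp (-(ν * t)) * ‖f‖) {g : ℝ → L2 D} (hg : IntervalIntegrable g volume a b) :
    ‖L (∫ s in a..b, semigroup S hμ (b - s) (forcingLift S μ (g s)))‖ ≤
      c * ∫ s in a..b, Real.exp (-(ν * (b - s))) * ‖g s‖ := by
  have hG : IntervalIntegrable (fun s => forcingLift S μ (g s)) volume a b := by
    rw [intervalIntegrable_iff] at hg ⊢
    exact (forcingLift S μ).integrable_comp hg
  rw [← L.intervalIntegral_comp_comm (intervalIntegrable_semigroup_apply S hμ b hG),
    ← intervalIntegral.integral_const_mul]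
  refine intervalIntegral.norm_integral_le_of_norm_le hab ?_ ?_
  · refine ae_of_all _ fun s hs => ?_
    rw [← mul_assoc]
    exact hL _ (by linarith [hs.2]) _
  · refine (hg.norm.continuousOn_mul ?_).const_mul c
    fun_prop

end Duhamel

/-! ### Controls -/

section Controls

variable {E : Type} [NormedAddCommGroup E] {t₁ t₂ : ℝ}

theorem Lp.intervalIntegrable (ψ : Lp E 2 (volume.restrict (Ioo t₁ t₂))) {a b : ℝ}
    (ha : t₁ ≤ a) (hab : a ≤ b) (hb : b ≤ t₂) : IntervalIntegrable ψ volume a b := by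
  rw [intervalIntegrable_iff_integrableOn_Ioo_of_le hab]
  exact IntegrableOn.mono_set (t := Ioo t₁ t₂) ((Lp.memLp ψ).integrable one_le_two)
    (Ioo_subset_Ioo ha hb)

theorem Lp.norm_sq_eq_setIntegral (ψ : Lp E 2 (volume.restrict (Ioo t₁ t₂))) :
    ‖ψ‖ ^ 2 = ∫ s in Ioo t₁ t₂, ‖ψ s‖ ^ 2 := by
  rw [Lp.norm_def, (Lp.memLp ψ).eLpNorm_eq_integral_rpow_norm (by norm_num) (by norm_num),
    ENNReal.toReal_ofReal (by positivity), ← Real.rpow_natCast, ← Real.rpow_mul (by positivity)]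
  simp

theorem Lp.integral_mul_norm_le (ψ : Lp E 2 (volume.restrict (Ioo t₁ t₂))) {a b : ℝ}
    (ha : t₁ ≤ a) (hab : a ≤ b) (hb : b ≤ t₂) {w : ℝ → ℝ} (hw : Continuous w)
    (hw0 : ∀ s, 0 ≤ w s) :
    ∫ s in a..b, w s * ‖ψ s‖ ≤ √(∫ s in a..b, w s ^ 2) * ‖ψ‖ := by
  have hsub : Ioo a b ⊆ Ioo t₁ t₂ := Ioo_subset_Ioo ha hb
  have hψ : MemLp ψ 2 (volume.restrict (Ioo a b)) :=
    (Lp.memLp ψ).mono_measure (Measure.restrict_mono hsub le_rfl)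
  have hwL : MemLp w 2 (volume.restrict (Ioo a b)) := by
    obtain ⟨C, hC⟩ := isCompact_Icc.exists_bound_of_continuousOn (hw.continuousOn (s := Icc a b))
    refine MemLp.of_bound hw.aestronglyMeasurable C ?_
    exact (ae_restrict_mem measurableSet_Ioo).mono fun s hs => hC s (Ioo_subset_Icc_self hs)
  have h2 : ENNReal.ofReal (2 : ℝ) = 2 := by norm_num
  have h := integral_mul_le_Lp_mul_Lq_of_nonneg (μ := volume.restrict (Ioo a b))
    Real.HolderConjugate.two_two (ae_of_all _ hw0) (ae_of_all _ fun s => norm_nonneg (ψ s))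
    (by rw [h2]; exact hwL) (by rw [h2]; exact hψ.norm)
  rw [intervalIntegral.integral_of_le hab, intervalIntegral.integral_of_le hab,
    integral_Ioc_eq_integral_Ioo, integral_Ioc_eq_integral_Ioo]
  refine h.trans ?_
  simp only [Real.rpow_two, ← Real.sqrt_eq_rpow]
  gcongr
  refine Real.sqrt_le_iff.2 ⟨norm_nonneg _, ?_⟩
  rw [Lp.norm_sq_eq_setIntegral]
  refine setIntegral_mono_set ((Lp.memLp ψ).norm.integrable_sq)
    (ae_of_all _ fun s => sq_nonneg _) hsub.eventuallyLE

theorem integral_exp_neg_le {ν : ℝ} (hν : 0 < ν) (a b : ℝ) :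
    ∫ s in a..b, Real.exp (-(ν * (b - s))) ≤ 1 / ν := by
  have hd : ∀ s ∈ uIcc a b, HasDerivAt (fun r => Real.exp (-(ν * (b - r))) / ν)
      (Real.exp (-(ν * (b - s)))) s := by
    intro s _
    have h := ((((hasDerivAt_id s).const_sub b).const_mul ν).neg.exp).div_const ν
    refine h.congr_deriv ?_
    field_simp
    simp
  rw [intervalIntegral.integral_eq_sub_of_hasDerivAt hd
    (Continuous.intervalIntegrable (by fun_prop) _ _)]
  have : 0 ≤ Real.exp (-(ν * (b - a))) / ν := by positivity
  simp only [sub_self, mul_zero, neg_zero, Real.exp_zero]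
  linarith

/-- Cauchy–Schwarz with the exponential kernel, whose `L²` norm is bounded independently of `t₁`;
this uniformity permits `t₁ → -∞`. -/
theorem Lp.integral_exp_mul_norm_le (ψ : Lp E 2 (volume.restrict (Ioo t₁ t₂))) {b ν : ℝ}
    (hν : 0 < ν) (hab : t₁ ≤ b) (hb : b ≤ t₂) :
    ∫ s in t₁..b, Real.exp (-(ν * (b - s))) * ‖ψ s‖ ≤ √(1 / (2 * ν)) * ‖ψ‖ := by
  refine (Lp.integral_mul_norm_le ψ le_rfl hab hb (by fun_prop)
    (fun s => (Real.exp_pos _).le)).trans ?_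
  gcongr
  refine le_trans (le_of_eq ?_) (integral_exp_neg_le (ν := 2 * ν) (by positivity) t₁ b)
  refine intervalIntegral.integral_congr fun s _ => ?_
  simp only [← Real.exp_nat_mul]
  congr 1
  push_cast
  ring

end Controls

/-! ### A priori estimates for mild solutions -/

section Apriori

variable (S : DirichletEigensystem D) {Q : L2 D →L[ℝ] L2 D} {B : L2 D → L2 D}

theorem forcing_eq (μ : ℝ) (ψ : ℝ → L2 D) (z : ℝ → PhaseSpace S) (s : ℝ) :
    nonlinearityLift S B μ (z s) + noiseLift S Q μ (ψ s) =
      forcingLift S μ (B (z s).fst + Q (ψ s)) := by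
  rw [nonlinearityLift_eq, noiseLift_eq, map_add]

theorem continuous_fst_phaseSpace : Continuous fun z : PhaseSpace S => z.fst :=
  WithLp.continuous_fst 2 _ _

variable {S}

theorem intervalIntegrable_forcing (hB : Continuous B) {t₁ t₂ : ℝ}
    (ψ : Lp (L2 D) 2 (volume.restrict (Ioo t₁ t₂))) {z : ℝ → PhaseSpace S} (hz : Continuous z)
    {a b : ℝ} (ha : t₁ ≤ a) (hab : a ≤ b) (hb : b ≤ t₂) :
    IntervalIntegrable (fun s => B (z s).fst + Q (ψ s)) volume a b := by
  refine IntervalIntegrable.add ?_ ?_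
  · exact (hB.comp ((continuous_fst_phaseSpace S).comp hz)).intervalIntegrable _ _
  · have := Lp.intervalIntegrable ψ ha hab hb
    rw [intervalIntegrable_iff] at this ⊢
    exact Q.integrable_comp this

theorem intervalIntegrable_forcingLift (μ : ℝ) {g : ℝ → L2 D} {a b : ℝ}
    (hg : IntervalIntegrable g volume a b) :
    IntervalIntegrable (fun s => forcingLift S μ (g s)) volume a b := by
  rw [intervalIntegrable_iff] at hg ⊢
  exact (forcingLift S μ).integrable_comp hg

theorem IsMildSolution.restart {μ : ℝ} {hμ : 0 < μ} (hB : Continuous B) {t₁ t₂ : ℝ}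
    {ψ : Lp (L2 D) 2 (volume.restrict (Ioo t₁ t₂))} {z : ℝ → PhaseSpace S} (hz : Continuous z)
    (h : IsMildSolution S Q B hμ t₁ t₂ ψ z) {a b : ℝ} (ha : t₁ ≤ a) (hab : a ≤ b) (hb : b ≤ t₂) :
    z b = semigroup S hμ (b - a) (z a) +
      ∫ s in a..b, semigroup S hμ (b - s) (forcingLift S μ (B (z s).fst + Q (ψ s))) := by
  have h1 := h a ⟨ha, hab.trans hb⟩
  have h2 := h b ⟨ha.trans hab, hb⟩
  simp only [forcing_eq] at h1 h2
  rw [h2, h1]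
  exact duhamel_restart S hμ _
    (intervalIntegrable_forcingLift μ (intervalIntegrable_forcing hB ψ hz le_rfl ha (hab.trans hb)))
    (intervalIntegrable_forcingLift μ (intervalIntegrable_forcing hB ψ hz ha hab hb))

theorem integral_mul_norm_forcing_le {γ : ℝ} (hγ0 : 0 ≤ γ) (hB : Continuous B)
    (hBγ : ∀ u, ‖B u‖ ≤ γ * ‖u‖) {t₁ t₂ : ℝ}
    (ψ : Lp (L2 D) 2 (volume.restrict (Ioo t₁ t₂))) {z : ℝ → PhaseSpace S} (hz : Continuous z)
    {a b X : ℝ} (ha : t₁ ≤ a) (hab : a ≤ b) (hb : b ≤ t₂)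
    (hX : ∀ s ∈ Icc t₁ t₂, ‖(z s).fst‖ ≤ X) {w : ℝ → ℝ} (hw : Continuous w) (hw0 : ∀ s, 0 ≤ w s) :
    ∫ s in a..b, w s * ‖B (z s).fst + Q (ψ s)‖ ≤
      γ * X * (∫ s in a..b, w s) + ‖Q‖ * ∫ s in a..b, w s * ‖ψ s‖ := by
  have hi1 : IntervalIntegrable (fun s => w s * ‖B (z s).fst + Q (ψ s)‖) volume a b :=
    (intervalIntegrable_forcing hB ψ hz ha hab hb).norm.continuousOn_mul hw.continuousOn
  have hi2 : IntervalIntegrable w volume a b := hw.intervalIntegrable _ _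
  have hi3 : IntervalIntegrable (fun s => w s * ‖ψ s‖) volume a b :=
    (Lp.intervalIntegrable ψ ha hab hb).norm.continuousOn_mul hw.continuousOn
  rw [← intervalIntegral.integral_const_mul, ← intervalIntegral.integral_const_mul,
    ← intervalIntegral.integral_add (hi2.const_mul _) (hi3.const_mul _)]
  refine intervalIntegral.integral_mono_on hab hi1 ((hi2.const_mul _).add (hi3.const_mul _))
    fun s hs => ?_
  have h1 : ‖B (z s).fst‖ ≤ γ * X :=
    (hBγ _).trans (mul_le_mul_of_nonneg_left (hX s ⟨ha.trans hs.1, hs.2.trans hb⟩) hγ0)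
  have h2 : ‖B (z s).fst + Q (ψ s)‖ ≤ γ * X + ‖Q‖ * ‖ψ s‖ :=
    (norm_add_le _ _).trans (add_le_add h1 (Q.le_opNorm _))
  have h3 := mul_le_mul_of_nonneg_left h2 (hw0 s)
  linarith

/-- The nonlinearity sees only the position, so a bound `X` on the position controls the Duhamel
term. The operator `L` is left general so that one estimate serves for the position, the full state
and the tails. -/
theorem IsMildSolution.norm_apply_le {μ ν K M γ : ℝ} {hμ : 0 < μ}
    (hdec : UniformDecay S hμ ν K M) (hγ0 : 0 ≤ γ) (hB : Continuous B)
    (hBγ : ∀ u, ‖B u‖ ≤ γ * ‖u‖) {t₁ t₂ : ℝ}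
    {ψ : Lp (L2 D) 2 (volume.restrict (Ioo t₁ t₂))} {z : ℝ → PhaseSpace S} (hz : Continuous z)
    (h : IsMildSolution S Q B hμ t₁ t₂ ψ z) {X : ℝ}
    (hX : ∀ s ∈ Icc t₁ t₂, ‖(z s).fst‖ ≤ X) {E : Type} [NormedAddCommGroup E] [NormedSpace ℝ E]
    [CompleteSpace E] (L : PhaseSpace S →L[ℝ] E) (hL1 : ∀ x, ‖L x‖ ≤ ‖x‖) {c : ℝ} (hc : 0 ≤ c)
    (hL : ∀ t, 0 ≤ t → ∀ f, ‖L (semigroup S hμ t (forcingLift S μ f))‖ ≤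
      c * Real.exp (-(ν * t)) * ‖f‖) {t : ℝ} (ht : t ∈ Icc t₁ t₂) :
    ‖L (z t)‖ ≤ M * Real.exp (-(ν * (t - t₁))) * ‖z t₁‖ +
      c * (γ * X / ν + ‖Q‖ * (√(1 / (2 * ν)) * ‖ψ‖)) := by
  have hX0 : 0 ≤ X := (norm_nonneg _).trans (hX t ht)
  rw [h.restart hB hz le_rfl ht.1 ht.2, map_add]
  refine (norm_add_le _ _).trans (add_le_add ?_ ?_)
  · exact (hL1 _).trans (hdec.norm_le _ (sub_nonneg.2 ht.1) _)
  · refine (norm_duhamel_le S hμ ht.1 L hL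
      (intervalIntegrable_forcing hB ψ hz le_rfl ht.1 ht.2)).trans ?_
    gcongr
    refine (integral_mul_norm_forcing_le hγ0 hB hBγ ψ hz le_rfl ht.1 ht.2 hX (by fun_prop)
      (fun s => (Real.exp_pos _).le)).trans ?_
    have e1 := integral_exp_neg_le hdec.rate_pos t₁ t
    have e2 := Lp.integral_exp_mul_norm_le ψ hdec.rate_pos ht.1 ht.2
    rw [← mul_one_div (γ * X)]
    gcongr

/-- `z` is, on every interval `[t₁, T]`, a mild solution with a control of norm at most `ρ`. -/
def IsDriven (S : DirichletEigensystem D) (Q : L2 D →L[ℝ] L2 D) (B : L2 D → L2 D) {μ : ℝ}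
    (hμ : 0 < μ) (T ρ : ℝ) (z : ℝ → PhaseSpace S) : Prop :=
  ∀ t₁ < T, ∃ ψ : Lp (L2 D) 2 (volume.restrict (Ioo t₁ T)),
    IsMildSolution S Q B hμ t₁ T ψ z ∧ ‖ψ‖ ≤ ρ

/-- The initial time is sent to `-∞`. The bound `R` only serves to kill the initial term and leaves
no trace in the conclusion. -/
theorem IsDriven.norm_apply_le_of_bound {μ ν K M γ : ℝ} {hμ : 0 < μ}
    (hdec : UniformDecay S hμ ν K M) (hγ0 : 0 ≤ γ) (hB : Continuous B)
    (hBγ : ∀ u, ‖B u‖ ≤ γ * ‖u‖) {T ρ : ℝ} {z : ℝ → PhaseSpace S} (hz : Continuous z)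
    (h : IsDriven S Q B hμ T ρ z) {R : ℝ} (hR : ∀ s ≤ T, ‖z s‖ ≤ R) {X : ℝ}
    (hX : ∀ s ≤ T, ‖(z s).fst‖ ≤ X) {E : Type} [NormedAddCommGroup E] [NormedSpace ℝ E]
    [CompleteSpace E] (L : PhaseSpace S →L[ℝ] E) (hL1 : ∀ x, ‖L x‖ ≤ ‖x‖) {c : ℝ} (hc : 0 ≤ c)
    (hL : ∀ t, 0 ≤ t → ∀ f, ‖L (semigroup S hμ t (forcingLift S μ f))‖ ≤
      c * Real.exp (-(ν * t)) * ‖f‖) {t : ℝ} (ht : t ≤ T) :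
    ‖L (z t)‖ ≤ c * (γ * X / ν + ‖Q‖ * (√(1 / (2 * ν)) * ρ)) := by
  have hM := hdec.const_pos
  have key : ∀ t₁ < t, ‖L (z t)‖ ≤ M * Real.exp (-(ν * (t - t₁))) * R +
      c * (γ * X / ν + ‖Q‖ * (√(1 / (2 * ν)) * ρ)) := by
    intro t₁ ht₁
    obtain ⟨ψ, hψ, hψρ⟩ := h t₁ (ht₁.trans_le ht)
    refine (hψ.norm_apply_le hdec hγ0 hB hBγ hz (fun s hs => hX s hs.2) L hL1 hc hL
      ⟨ht₁.le, ht⟩).trans ?_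
    have := hR t₁ (ht₁.le.trans ht)
    gcongr
  have hlim : Tendsto (fun t₁ => M * Real.exp (-(ν * (t - t₁))) * R +
      c * (γ * X / ν + ‖Q‖ * (√(1 / (2 * ν)) * ρ))) atBot
      (𝓝 (M * 0 * R + c * (γ * X / ν + ‖Q‖ * (√(1 / (2 * ν)) * ρ)))) := by
    refine ((Tendsto.const_mul M (Real.tendsto_exp_atBot.comp ?_)).mul_const R).add_const _
    refine tendsto_neg_atTop_atBot.comp (Tendsto.const_mul_atTop hdec.rate_pos ?_)
    exact tendsto_atTop_add_const_left _ t tendsto_neg_atBot_atTop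
  have := ge_of_tendsto hlim ((eventually_lt_atBot t).mono key)
  simpa using this

/-- Bounded solutions on a half line are controlled by the size of the control alone. -/
theorem exists_norm_apply_le_of_isDriven (S : DirichletEigensystem D) (Q : L2 D →L[ℝ] L2 D)
    {μ ν K M γ : ℝ} {hμ : 0 < μ}
    (hdec : UniformDecay S hμ ν K M) (hγ0 : 0 ≤ γ) (hKγ : K * γ < ν) (hB : Continuous B)
    (hBγ : ∀ u, ‖B u‖ ≤ γ * ‖u‖) :
    ∃ C : ℝ, 0 ≤ C ∧ ∀ (T ρ : ℝ) (z : ℝ → PhaseSpace S), Continuous z →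
      IsDriven S Q B hμ T ρ z → ∀ R : ℝ, (∀ s ≤ T, ‖z s‖ ≤ R) →
      ∀ (E : Type) [NormedAddCommGroup E] [NormedSpace ℝ E] [CompleteSpace E]
        (L : PhaseSpace S →L[ℝ] E) (_ : ∀ x, ‖L x‖ ≤ ‖x‖) (c : ℝ), 0 ≤ c →
        (∀ t, 0 ≤ t → ∀ f, ‖L (semigroup S hμ t (forcingLift S μ f))‖ ≤
          c * Real.exp (-(ν * t)) * ‖f‖) → ∀ t ≤ T, ‖L (z t)‖ ≤ c * (C * ρ) := by
  have hν := hdec.rate_pos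
  have hK := hdec.gain_pos
  set q := ‖Q‖ * √(1 / (2 * ν)) with hq
  have hq0 : 0 ≤ q := by positivity
  -- The loop gain through the nonlinearity; `θ < 1` allows `θ X` to be absorbed.
  set θ := K * γ / ν with hθ
  have hθ1 : 0 < 1 - θ := by
    rw [hθ, sub_pos, div_lt_one hν]
    exact hKγ
  refine ⟨γ / ν * (K * q / (1 - θ)) + q, by positivity, ?_⟩
  intro T ρ z hz h R hR E _ _ _ L hL1 c hc hL t ht
  set X := ⨆ s : Iic T, ‖(z s).fst‖ with hXdef
  have hbdd : BddAbove (range fun s : Iic T => ‖(z s).fst‖) :=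
    ⟨R, by rintro _ ⟨s, rfl⟩; exact (norm_fst_le S _).trans (hR s s.2)⟩
  have hX : ∀ s ≤ T, ‖(z s).fst‖ ≤ X := fun s hs => le_ciSup hbdd ⟨s, hs⟩
  let F : PhaseSpace S →L[ℝ] L2 D := WithLp.fstL 2 ℝ (L2 D) (HScale S (-1))
  -- The estimate applied to the position itself closes on the supremum `X`, which is finite thanks
  -- to `R`.
  have hXle : X ≤ K * (γ * X / ν + ‖Q‖ * (√(1 / (2 * ν)) * ρ)) := by
    have : Nonempty (Iic T) := ⟨⟨T, mem_Iic.2 le_rfl⟩⟩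
    refine ciSup_le fun s => ?_
    exact h.norm_apply_le_of_bound hdec hγ0 hB hBγ hz hR hX F (norm_fst_le S) hK.le hdec.fst_le s.2
  have hXle' : X ≤ K * q / (1 - θ) * ρ := by
    rw [div_mul_eq_mul_div, le_div_iff₀ hθ1]
    have e : K * (γ * X / ν + ‖Q‖ * (√(1 / (2 * ν)) * ρ)) = θ * X + K * q * ρ := by
      rw [hθ, hq]
      ring
    rw [e] at hXle
    linarith
  refine (h.norm_apply_le_of_bound hdec hγ0 hB hBγ hz hR hX L hL1 hc hL ht).trans ?_
  gcongr
  have e : (γ / ν * (K * q / (1 - θ)) + q) * ρ =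
      γ / ν * (K * q / (1 - θ) * ρ) + ‖Q‖ * (√(1 / (2 * ν)) * ρ) := by
    rw [hq]
    ring
  rw [e, mul_div_right_comm]
  gcongr

/-- The increments of a mild solution. -/
theorem IsMildSolution.norm_sub_le {μ ν K M γ : ℝ} {hμ : 0 < μ}
    (hdec : UniformDecay S hμ ν K M) (hγ0 : 0 ≤ γ) (hB : Continuous B)
    (hBγ : ∀ u, ‖B u‖ ≤ γ * ‖u‖) {t₁ t₂ : ℝ}
    {ψ : Lp (L2 D) 2 (volume.restrict (Ioo t₁ t₂))} {z : ℝ → PhaseSpace S} (hz : Continuous z)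
    (h : IsMildSolution S Q B hμ t₁ t₂ ψ z) {X : ℝ}
    (hX : ∀ s ∈ Icc t₁ t₂, ‖(z s).fst‖ ≤ X) {a b : ℝ} (ha : t₁ ≤ a) (hab : a ≤ b) (hb : b ≤ t₂) :
    ‖z b - z a‖ ≤ ‖semigroup S hμ (b - a) (z a) - z a‖ +
      M * ‖forcingLift S μ‖ * (γ * X * (b - a) + ‖Q‖ * (√(b - a) * ‖ψ‖)) := by
  have hM := hdec.const_pos
  have hν := hdec.rate_pos
  have e : z b - z a = (semigroup S hμ (b - a) (z a) - z a) +
      ∫ s in a..b, semigroup S hμ (b - s) (forcingLift S μ (B (z s).fst + Q (ψ s))) := by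
    rw [h.restart hB hz ha hab hb]
    abel
  rw [e]
  refine (norm_add_le _ _).trans (add_le_add_right ?_ _)
  -- Decay is irrelevant on a short interval, so the exponential is bounded by `1`.
  have h1 := norm_duhamel_le S hμ hab (c := M * ‖forcingLift S μ‖) (ν := 0)
    (ContinuousLinearMap.id ℝ _) (fun t ht f => by
      simp only [ContinuousLinearMap.id_apply, zero_mul, neg_zero, Real.exp_zero, mul_one]
      refine (hdec.norm_le t ht _).trans ?_
      rw [mul_assoc M ‖_‖]
      have : Real.exp (-(ν * t)) ≤ 1 := Real.exp_le_one_iff.2 (by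
        have : 0 ≤ ν * t := by positivity
        linarith)
      refine mul_le_mul (mul_le_of_le_one_right hM.le this) ((forcingLift S μ).le_opNorm f)
        (norm_nonneg _) hM.le) (intervalIntegrable_forcing (Q := Q) hB ψ hz ha hab hb)
  refine h1.trans ?_
  gcongr
  refine (integral_mul_norm_forcing_le hγ0 hB hBγ ψ hz ha hab hb hX (by fun_prop)
      (fun s => (Real.exp_pos _).le)).trans ?_
  have h2 := Lp.integral_mul_norm_le ψ ha hab hb (w := fun _ => 1) continuous_const
    (fun _ => zero_le_one)
  simp only [zero_mul, neg_zero, Real.exp_zero, one_pow, intervalIntegral.integral_const,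
    smul_eq_mul, mul_one] at h2 ⊢
  gcongr

end Apriori

/-! ### Weak compactness -/

/-- A bounded family in a Hilbert space converges weakly along any ultrafilter. -/
theorem exists_weak_limit {ι H : Type*} [NormedAddCommGroup H] [InnerProductSpace ℝ H]
    [CompleteSpace H] (l : Ultrafilter ι) {ψ : ι → H} {R : ℝ} (h : ∀ᶠ i in l, ‖ψ i‖ ≤ R) :
    ∃ φ : H, ‖φ‖ ≤ R ∧ ∀ L : H →L[ℝ] ℝ, Tendsto (fun i => L (ψ i)) l (𝓝 (L φ)) := by
  -- The Riesz isometry carries the family into a closed ball of the dual, which is weak-star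
  -- compact by Banach–Alaoglu.
  let J := InnerProductSpace.toDual ℝ H
  let f : ι → WeakDual ℝ H := fun i => StrongDual.toWeakDual (J (ψ i))
  obtain ⟨x, hx, hlx⟩ := isCompact_iff_ultrafilter_le_nhds.1
    (WeakDual.isCompact_closedBall (𝕜 := ℝ) (0 : StrongDual ℝ H) R) (l.map f) (by
      rw [le_principal_iff]
      refine h.mono fun i hi => ?_
      simp only [f, mem_preimage, Metric.mem_closedBall, dist_zero_right]
      exact (J.norm_map (ψ i)).trans_le hi)
  refine ⟨J.symm (WeakDual.toStrongDual x), ?_, fun L => ?_⟩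
  · rw [J.symm.norm_map]
    simpa using hx
  · have h1 : Tendsto f l (𝓝 x) := hlx
    have h2 := ((WeakDual.eval_continuous (J.symm L)).tendsto x).comp h1
    have e1 : ∀ y : H, L y = J y (J.symm L) := fun y => by
      rw [InnerProductSpace.toDual_apply_apply, real_inner_comm,
        ← InnerProductSpace.toDual_apply_apply (𝕜 := ℝ)]
      exact congrArg (fun F : StrongDual ℝ H => F y) (J.apply_symm_apply L).symm
    rw [e1, LinearIsometryEquiv.apply_symm_apply]
    exact h2.congr fun i => (e1 (ψ i)).symm

/-! ### The action functional -/

section Action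

variable {S : DirichletEigensystem D} {Q : L2 D →L[ℝ] L2 D} {B : L2 D → L2 D}

theorem integral_noise_congr {μ : ℝ} {hμ : 0 < μ} {t₁ t₂ t : ℝ} (ht : t ∈ Icc t₁ t₂)
    {ψ ψ' : ℝ → L2 D} (h : ψ =ᵐ[volume.restrict (Ioo t₁ t₂)] ψ')
    (F : ℝ → L2 D → PhaseSpace S) :
    ∫ s in t₁..t, semigroup S hμ (t - s) (F s (ψ s)) =
      ∫ s in t₁..t, semigroup S hμ (t - s) (F s (ψ' s)) := by
  rw [intervalIntegral.integral_of_le ht.1, intervalIntegral.integral_of_le ht.1,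
    integral_Ioc_eq_integral_Ioo, integral_Ioc_eq_integral_Ioo]
  refine integral_congr_ae ?_
  exact (ae_restrict_of_ae_restrict_of_subset (Ioo_subset_Ioo le_rfl ht.2) h).mono
    fun s hs => by simp only [hs]

theorem IsMildSolution.exists_restrict {μ : ℝ} {hμ : 0 < μ} (hB : Continuous B) {t₁ t₂ : ℝ}
    {ψ : Lp (L2 D) 2 (volume.restrict (Ioo t₁ t₂))} {z : ℝ → PhaseSpace S} (hz : Continuous z)
    (h : IsMildSolution S Q B hμ t₁ t₂ ψ z) {a b : ℝ} (ha : t₁ ≤ a) (hb : b ≤ t₂) :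
    ∃ ψ' : Lp (L2 D) 2 (volume.restrict (Ioo a b)), IsMildSolution S Q B hμ a b ψ' z ∧
      ‖ψ'‖ ^ 2 = ∫ s in Ioo a b, ‖ψ s‖ ^ 2 := by
  have hψ : MemLp ψ 2 (volume.restrict (Ioo a b)) :=
    (Lp.memLp ψ).mono_measure (Measure.restrict_mono (Ioo_subset_Ioo ha hb) le_rfl)
  refine ⟨hψ.toLp, fun t ht => ?_, ?_⟩
  · rw [← integral_noise_congr ht hψ.coeFn_toLp.symm
      (fun s x => nonlinearityLift S B μ (z s) + noiseLift S Q μ x),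
      h.restart hB hz ha ht.1 (ht.2.trans hb)]
    simp only [forcing_eq]
  · rw [Lp.norm_sq_eq_setIntegral]
    exact integral_congr_ae (hψ.coeFn_toLp.mono fun s hs => by simp only [hs])

/-- A control on the long interval restricts to controls on both pieces, and the squared norms add.
-/
theorem action_add_le {μ : ℝ} {hμ : 0 < μ} (hB : Continuous B) {z : ℝ → PhaseSpace S}
    (hz : Continuous z) {t₁ T t₂ : ℝ} (h1 : t₁ ≤ T) (h2 : T ≤ t₂) :
    action S Q B hμ t₁ T z + action S Q B hμ T t₂ z ≤ action S Q B hμ t₁ t₂ z := by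
  refine le_iInf₂ fun ψ hψ => ?_
  obtain ⟨ψ₁, hm1, hn1⟩ := hψ.exists_restrict hB hz le_rfl h2
  obtain ⟨ψ₂, hm2, hn2⟩ := hψ.exists_restrict hB hz h1 le_rfl
  refine (add_le_add (iInf₂_le ψ₁ hm1) (iInf₂_le ψ₂ hm2)).trans ?_
  rw [← ENNReal.ofReal_add (by positivity) (by positivity)]
  refine ENNReal.ofReal_le_ofReal (le_of_eq ?_)
  have hint : IntegrableOn (fun s => ‖ψ s‖ ^ 2) (Ioo t₁ t₂) := (Lp.memLp ψ).norm.integrable_sq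
  have hint' : ∀ a b, t₁ ≤ a → b ≤ t₂ → IntegrableOn (fun s => ‖ψ s‖ ^ 2) (Ioc a b) :=
    fun a b ha hb => by
      rw [integrableOn_Ioc_iff_integrableOn_Ioo]
      exact hint.mono_set (Ioo_subset_Ioo ha hb)
  rw [hn1, hn2, Lp.norm_sq_eq_setIntegral, ← integral_Ioc_eq_integral_Ioo,
    ← integral_Ioc_eq_integral_Ioo, ← integral_Ioc_eq_integral_Ioo,
    ← intervalIntegral.integral_of_le h1, ← intervalIntegral.integral_of_le h2,
    ← intervalIntegral.integral_of_le (h1.trans h2), ← mul_add,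
    intervalIntegral.integral_add_adjacent_intervals
      ((intervalIntegrable_iff_integrableOn_Ioc_of_le h1).2 (hint' _ _ le_rfl h2))
      ((intervalIntegrable_iff_integrableOn_Ioc_of_le h2).2 (hint' _ _ h1 le_rfl))]

/-- The strict inequality dispenses with attainment of the infimum; this is why levels are raised
from `r` to some `r' > r` below. -/
theorem exists_control_of_action_lt {μ : ℝ} {hμ : 0 < μ} {t₁ t₂ r : ℝ} {z : ℝ → PhaseSpace S}
    (h : action S Q B hμ t₁ t₂ z < ENNReal.ofReal r) :
    ∃ ψ : Lp (L2 D) 2 (volume.restrict (Ioo t₁ t₂)), IsMildSolution S Q B hμ t₁ t₂ ψ z ∧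
      ‖ψ‖ ≤ √(2 * r) := by
  obtain ⟨ψ, hψ⟩ := iInf_lt_iff.1 h
  obtain ⟨hm, hlt⟩ := iInf_lt_iff.1 hψ
  have hlt' := (ENNReal.ofReal_lt_ofReal_iff_of_nonneg (by positivity)).1 hlt
  exact ⟨ψ, hm, Real.le_sqrt_of_sq_le (by linarith)⟩

theorem isDriven_of_halfLineAction_le {μ : ℝ} {hμ : 0 < μ} {r r' : ℝ} (hr : 0 ≤ r) (hrr : r < r')
    {z : C(Iic (0 : ℝ), PhaseSpace S)} (h : halfLineAction S Q B hμ z ≤ ENNReal.ofReal r) :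
    IsDriven S Q B hμ 0 √(2 * r') (IicExtend z) := by
  intro t₁ ht₁
  refine exists_control_of_action_lt (lt_of_le_of_lt ?_
    ((ENNReal.ofReal_lt_ofReal_iff_of_nonneg hr).2 hrr))
  have h2 := (le_iSup₂ (f := fun (t : ℝ) (_ : 0 < t) => action S Q B hμ (-t) 0 (IicExtend z))
    (-t₁) (neg_pos.2 ht₁)).trans h
  simpa using h2

theorem continuous_IicExtend (z : C(Iic (0 : ℝ), PhaseSpace S)) : Continuous (IicExtend z) :=
  z.continuous.comp ((continuous_const.min continuous_id).subtype_mk _)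

/-- The action on `(-∞, T]` is small for `T` near `-∞`. -/
theorem exists_isDriven_small {μ : ℝ} {hμ : 0 < μ} (hB : Continuous B) {r : ℝ}
    {z : C(Iic (0 : ℝ), PhaseSpace S)} (h : halfLineAction S Q B hμ z ≤ ENNReal.ofReal r)
    {ε : ℝ} (hε : 0 < ε) : ∃ T < 0, IsDriven S Q B hμ T √(2 * ε) (IicExtend z) := by
  have hz := continuous_IicExtend z
  set s := halfLineAction S Q B hμ z with hs
  have hs' : s ≠ ⊤ := ne_top_of_le_ne_top ENNReal.ofReal_ne_top h
  have hε' : 0 < ENNReal.ofReal ε := ENNReal.ofReal_pos.2 hε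
  have hact : ∀ t, 0 < t → action S Q B hμ (-t) 0 (IicExtend z) ≤ s := fun t ht =>
    le_iSup₂ (f := fun (t : ℝ) (_ : 0 < t) => action S Q B hμ (-t) 0 (IicExtend z)) t ht
  -- The supremum is finite, so some `[-t, 0]` carries all but `ε` of the action; superadditivity
  -- leaves less than `ε` for any interval ending at `-t`.
  obtain ⟨t, ht, hts⟩ : ∃ t, 0 < t ∧
      s < action S Q B hμ (-t) 0 (IicExtend z) + ENNReal.ofReal ε := by
    by_contra! hcon
    have h1 : s + ENNReal.ofReal ε ≤ s := by
      conv_lhs => rw [hs, halfLineAction]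
      rw [ENNReal.biSup_add' ⟨1, one_pos⟩]
      exact iSup₂_le hcon
    exact absurd (ENNReal.lt_add_right hs' hε'.ne') (not_lt.2 h1)
  refine ⟨-t, neg_lt_zero.2 ht, fun t₁ ht₁ => exists_control_of_action_lt ?_⟩
  have h1 := action_add_le (Q := Q) (hμ := hμ) hB hz ht₁.le (neg_nonpos.2 ht.le)
  have h2 := hact (-t₁) (by linarith)
  rw [neg_neg] at h2
  have h3 := (h1.trans h2).trans_lt hts
  rw [add_comm] at h3
  exact lt_of_add_lt_add_left h3

theorem UniformDecay.norm_forcing_le {μ ν K M : ℝ} {hμ : 0 < μ} (hdec : UniformDecay S hμ ν K M)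
    {t : ℝ} (ht : 0 ≤ t) (f : L2 D) : ‖semigroup S hμ t (forcingLift S μ f)‖ ≤
      M * ‖forcingLift S μ‖ * Real.exp (-(ν * t)) * ‖f‖ := by
  have hM := hdec.const_pos
  refine (hdec.norm_le t ht _).trans ?_
  calc M * Real.exp (-(ν * t)) * ‖forcingLift S μ f‖
      ≤ M * Real.exp (-(ν * t)) * (‖forcingLift S μ‖ * ‖f‖) := by
        gcongr
        exact (forcingLift S μ).le_opNorm f
    _ = _ := by ring

/-- The solution at time `t` depends continuously and linearly on the control. -/
theorem exists_controlCLM (Q : L2 D →L[ℝ] L2 D) {μ ν K M : ℝ} {hμ : 0 < μ}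
    (hdec : UniformDecay S hμ ν K M) {t₁ t₂ t : ℝ} (ht : t ∈ Icc t₁ t₂) :
    ∃ L : Lp (L2 D) 2 (volume.restrict (Ioo t₁ t₂)) →L[ℝ] PhaseSpace S, ∀ ψ,
      L ψ = ∫ s in t₁..t, semigroup S hμ (t - s) (forcingLift S μ (Q (ψ s))) := by
  have hM := hdec.const_pos
  have hQ : ∀ ψ : Lp (L2 D) 2 (volume.restrict (Ioo t₁ t₂)),
      IntervalIntegrable (fun s => Q (ψ s)) volume t₁ t := fun ψ => by
    have := Lp.intervalIntegrable ψ le_rfl ht.1 ht.2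
    rw [intervalIntegrable_iff] at this ⊢
    exact Q.integrable_comp this
  have hint := fun ψ => intervalIntegrable_semigroup_apply S hμ t
    (intervalIntegrable_forcingLift (S := S) μ (hQ ψ))
  refine ⟨LinearMap.mkContinuous
    { toFun := fun ψ => ∫ s in t₁..t, semigroup S hμ (t - s) (forcingLift S μ (Q (ψ s)))
      map_add' := fun ψ φ => ?_
      map_smul' := fun c ψ => ?_ }
    (M * ‖forcingLift S μ‖ * (‖Q‖ * √(1 / (2 * ν)))) (fun ψ => ?_), fun ψ => rfl⟩
  · rw [← intervalIntegral.integral_add (hint ψ) (hint φ),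
      integral_noise_congr ht (Lp.coeFn_add ψ φ) (fun _ x => forcingLift S μ (Q x))]
    simp only [Pi.add_apply, map_add]
  · rw [integral_noise_congr ht (Lp.coeFn_smul c ψ) (fun _ x => forcingLift S μ (Q x))]
    simp only [Pi.smul_apply, map_smul, intervalIntegral.integral_smul, RingHom.id_apply]
  · simp only [LinearMap.coe_mk, AddHom.coe_mk]
    refine (norm_duhamel_le S hμ ht.1 (ContinuousLinearMap.id ℝ _)
      (fun τ hτ f => hdec.norm_forcing_le hτ f) (hQ ψ)).trans ?_
    rw [mul_assoc (M * _)]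
    gcongr
    rw [mul_assoc]
    refine le_trans ?_ (mul_le_mul_of_nonneg_left
      (Lp.integral_exp_mul_norm_le ψ hdec.rate_pos ht.1 ht.2) (norm_nonneg Q))
    rw [← intervalIntegral.integral_const_mul]
    refine intervalIntegral.integral_mono_on ht.1
      ((hQ ψ).norm.continuousOn_mul (by fun_prop))
      (((Lp.intervalIntegrable ψ le_rfl ht.1 ht.2).norm.continuousOn_mul
        (by fun_prop)).const_mul _) fun s _ => ?_
    calc _ ≤ Real.exp (-(ν * (t - s))) * (‖Q‖ * ‖ψ s‖) := by
          gcongr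
          exact Q.le_opNorm _
      _ = _ := by ring

theorem tendsto_integral_nonlinearity {ι : Type*} {l : Filter ι} {μ γ : ℝ} {hμ : 0 < μ}
    (hB : Continuous B) (hLip : ∀ u v, ‖B u - B v‖ ≤ γ * ‖u - v‖) (hγ0 : 0 ≤ γ) {t₁ t₂ t : ℝ}
    (ht : t ∈ Icc t₁ t₂)
    {w : ι → ℝ → PhaseSpace S} {z : ℝ → PhaseSpace S} (hw : ∀ i, Continuous (w i))
    (hz : Continuous z) (h : TendstoUniformlyOn w z l (Icc t₁ t₂)) :
    Tendsto (fun i => ∫ s in t₁..t, semigroup S hμ (t - s) (forcingLift S μ (B (w i s).fst))) l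
      (𝓝 (∫ s in t₁..t, semigroup S hμ (t - s) (forcingLift S μ (B (z s).fst)))) := by
  obtain ⟨C, hC0, hC⟩ := exists_norm_semigroup_le S hμ (t - t₁)
  set A := C * (‖forcingLift S μ‖ * γ) with hA
  have hA0 : 0 ≤ A := by positivity
  have hint : ∀ {y : ℝ → PhaseSpace S}, Continuous y → IntervalIntegrable
      (fun s => semigroup S hμ (t - s) (forcingLift S μ (B (y s).fst))) volume t₁ t := fun hy =>
    intervalIntegrable_semigroup_apply S hμ t (intervalIntegrable_forcingLift μ
      ((hB.comp ((continuous_fst_phaseSpace S).comp hy)).intervalIntegrable _ _))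
  have ht0 : 0 ≤ t - t₁ := sub_nonneg.2 ht.1
  refine Metric.tendsto_nhds.2 fun ε hε => ?_
  -- The `+ 1` covers the degenerate cases `A = 0` and `t = t₁`, and makes the final inequality
  -- strict.
  have hpos : 0 < A * (t - t₁) + 1 := by positivity
  filter_upwards [Metric.tendstoUniformlyOn_iff.1 h (ε / (A * (t - t₁) + 1)) (by positivity)]
    with i hi
  rw [dist_eq_norm, ← intervalIntegral.integral_sub (hint (hw i)) (hint hz)]
  have hb : ∀ s ∈ uIoc t₁ t, ‖semigroup S hμ (t - s) (forcingLift S μ (B (w i s).fst)) -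
      semigroup S hμ (t - s) (forcingLift S μ (B (z s).fst))‖ ≤
      A * (ε / (A * (t - t₁) + 1)) := by
    intro s hs
    rw [uIoc_of_le ht.1] at hs
    rw [← map_sub, ← map_sub]
    refine (hC _ (by rw [abs_of_nonneg] <;> linarith [hs.1, hs.2]) _).trans ?_
    rw [hA, mul_assoc, mul_assoc]
    refine mul_le_mul_of_nonneg_left (((forcingLift S μ).le_opNorm _).trans ?_) hC0.le
    refine mul_le_mul_of_nonneg_left ((hLip _ _).trans ?_) (norm_nonneg _)
    refine mul_le_mul_of_nonneg_left ?_ hγ0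
    have h1 := hi s ⟨hs.1.le, hs.2.trans ht.2⟩
    rw [dist_comm, dist_eq_norm] at h1
    exact (norm_fst_le S (w i s - z s)).trans h1.le
  refine (intervalIntegral.norm_integral_le_of_norm_le_const hb).trans_lt ?_
  rw [abs_of_nonneg ht0, mul_div_assoc', div_mul_eq_mul_div, div_lt_iff₀ hpos]
  linarith

/-- Lower semicontinuity of the action under uniform convergence. -/
theorem action_le_of_tendstoUniformlyOn {ι : Type*} (l : Ultrafilter ι) {μ ν K M γ : ℝ}
    {hμ : 0 < μ} (hdec : UniformDecay S hμ ν K M)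
    (hB : Continuous B) (hLip : ∀ u v, ‖B u - B v‖ ≤ γ * ‖u - v‖) (hγ0 : 0 ≤ γ) {t₁ t₂ r : ℝ}
    (h12 : t₁ ≤ t₂) (hr : 0 ≤ r)
    {w : ι → ℝ → PhaseSpace S} {z : ℝ → PhaseSpace S} (hw : ∀ i, Continuous (w i))
    (hz : Continuous z) (h : TendstoUniformlyOn w z l (Icc t₁ t₂))
    (hact : ∀ᶠ i in l, action S Q B hμ t₁ t₂ (w i) ≤ ENNReal.ofReal r) :
    action S Q B hμ t₁ t₂ z ≤ ENNReal.ofReal r := by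
  -- It suffices to reach every level above `r`, at which near-optimal controls exist.
  refine le_of_forall_gt_imp_ge_of_dense fun c hc => ?_
  rcases eq_or_ne c ⊤ with rfl | hctop
  · exact le_top
  obtain ⟨r', rfl⟩ : ∃ r', ENNReal.ofReal r' = c := ⟨c.toReal, ENNReal.ofReal_toReal hctop⟩
  have hrr : r < r' := (ENNReal.ofReal_lt_ofReal_iff_of_nonneg hr).1 hc
  have hex : ∀ i, ∃ ψ : Lp (L2 D) 2 (volume.restrict (Ioo t₁ t₂)),
      action S Q B hμ t₁ t₂ (w i) ≤ ENNReal.ofReal r →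
        IsMildSolution S Q B hμ t₁ t₂ ψ (w i) ∧ ‖ψ‖ ≤ √(2 * r') := by
    intro i
    by_cases hi : action S Q B hμ t₁ t₂ (w i) ≤ ENNReal.ofReal r
    · obtain ⟨ψ, hψ⟩ := exists_control_of_action_lt (hi.trans_lt hc)
      exact ⟨ψ, fun _ => hψ⟩
    · exact ⟨0, fun h => absurd h hi⟩
  choose ψ hψ using hex
  obtain ⟨φ, hφ, hweak⟩ := exists_weak_limit l (hact.mono fun i hi => (hψ i hi).2)
  have hmild : IsMildSolution S Q B hμ t₁ t₂ φ z := by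
    intro t ht
    obtain ⟨L, hL⟩ := exists_controlCLM Q hdec ht
    have hsplit : ∀ (y : ℝ → PhaseSpace S), Continuous y →
        ∀ η : Lp (L2 D) 2 (volume.restrict (Ioo t₁ t₂)),
        ∫ s in t₁..t, semigroup S hμ (t - s) (nonlinearityLift S B μ (y s) +
          noiseLift S Q μ (η s)) =
        (∫ s in t₁..t, semigroup S hμ (t - s) (forcingLift S μ (B (y s).fst))) + L η := by
      intro y hy η
      rw [hL, ← intervalIntegral.integral_add]
      · simp only [nonlinearityLift_eq, noiseLift_eq, map_add]
      · exact intervalIntegrable_semigroup_apply S hμ t (intervalIntegrable_forcingLift μ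
          ((hB.comp ((continuous_fst_phaseSpace S).comp hy)).intervalIntegrable _ _))
      · refine intervalIntegrable_semigroup_apply S hμ t (intervalIntegrable_forcingLift μ ?_)
        have := Lp.intervalIntegrable η le_rfl ht.1 ht.2
        rw [intervalIntegrable_iff] at this ⊢
        exact Q.integrable_comp this
    have hpt : ∀ s ∈ Icc t₁ t₂, Tendsto (fun i => w i s) l (𝓝 (z s)) := fun s hs =>
      h.tendsto_at hs
    have hlim : Tendsto (fun i => L (ψ i)) l (𝓝 (z t - semigroup S hμ (t - t₁) (z t₁) -
        ∫ s in t₁..t, semigroup S hμ (t - s) (forcingLift S μ (B (z s).fst)))) := by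
      have h1 := ((hpt t ht).sub (((semigroup S hμ (t - t₁)).continuous.tendsto _).comp
        (hpt t₁ ⟨le_rfl, h12⟩))).sub
        (tendsto_integral_nonlinearity (hμ := hμ) hB hLip hγ0 ht hw hz h)
      refine h1.congr' (hact.mono fun i hi => ?_)
      have h2 := (hψ i hi).1 t ht
      rw [hsplit _ (hw i)] at h2
      simp only [Function.comp_apply]
      rw [sub_sub, sub_eq_iff_eq_add, h2]
      abel
    have heq : L φ = z t - semigroup S hμ (t - t₁) (z t₁) -
        ∫ s in t₁..t, semigroup S hμ (t - s) (forcingLift S μ (B (z s).fst)) := by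
      -- The images `L (ψ i)` converge in norm by the equation and weakly to `L φ`; testing with
      -- functionals identifies the two limits, so `φ` drives the limit path.
      refine (SeparatingDual.eq_iff_forall_dual_eq (R := ℝ)).2 fun g => ?_
      exact tendsto_nhds_unique (hweak (g.comp L)) ((g.continuous.tendsto _).comp hlim)
    rw [hsplit z hz, heq]
    abel
  refine (iInf₂_le φ hmild).trans (ENNReal.ofReal_le_ofReal ?_)
  have := pow_le_pow_left₀ (norm_nonneg φ) hφ 2
  rw [Real.sq_sqrt (by linarith)] at this
  linarith

end Action

/-! ### Compactness of the level sets -/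

/-- The case `δ = 0` of the hypothesis, since the norm of `H⁰` is that of `L²(D)`. Taking the
maximum with `0` makes the constant nonnegative and keeps it below `α 0 > 0`. -/
theorem IsAdmissibleNonlinearity.exists_lipschitz {S : DirichletEigensystem D} {β : ℝ}
    {B : L2 D → L2 D} (hβ : 0 ≤ 1 + 2 * β) (hB : IsAdmissibleNonlinearity S β B) :
    ∃ γ, 0 ≤ γ ∧ γ < S.α 0 ∧ ∀ u v, ‖B u - B v‖ ≤ γ * ‖u - v‖ := by
  obtain ⟨γ, hγ, h⟩ := hB.lipschitz 0 ⟨le_rfl, hβ⟩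
  have hmem : ∀ u, MemScale S 0 u := fun u => by
    simpa [MemScale] using S.summable_coeff_sq u
  have hnorm : ∀ u, scaleNorm S 0 u = ‖u‖ := fun u => by
    rw [scaleNorm]
    simp only [Real.rpow_zero, one_mul]
    rw [← S.norm_sq_eq_tsum, Real.sqrt_sq (norm_nonneg u)]
  refine ⟨max γ 0, le_max_right _ _, max_lt hγ S.first_pos, fun u v => ?_⟩
  have h1 := h u v (hmem u) (hmem v)
  rw [hnorm, hnorm] at h1
  exact h1.trans (by gcongr; exact le_max_left _ _)

theorem DirichletEigensystem.HasWeylGrowth.tendsto_atTop {S : DirichletEigensystem D}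
    (hd : 1 ≤ d) (hS : S.HasWeylGrowth) : Tendsto S.α atTop atTop := by
  obtain ⟨C, hC, h⟩ := hS
  refine tendsto_atTop_mono (fun k => (h k).1) ?_
  refine Tendsto.const_mul_atTop (inv_pos.2 hC) ?_
  have hd' : (0 : ℝ) < 2 / d := by
    have : (0 : ℝ) < d := by exact_mod_cast hd
    positivity
  exact (tendsto_rpow_atTop hd').comp
    (tendsto_atTop_add_const_right _ 1 tendsto_natCast_atTop_atTop)

/-- Arzelà–Ascoli on the half line, for paths with a common modulus of continuity and values in a
common compact set. -/
theorem isCompact_setOf_modulus {E : Type*} [MetricSpace E] {T : Set E} (hT : IsCompact T)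
    {δ : ℝ → ℝ} (hδ : ∀ ε > 0, 0 < δ ε) :
    IsCompact {z : C(Iic (0 : ℝ), E) | (∀ t, z t ∈ T) ∧
      ∀ ε > 0, ∀ s t, dist s t < δ ε → dist (z s) (z t) ≤ ε} := by
  refine ArzelaAscoli.isCompact_of_equicontinuous _ ?_ ?_
  · have himg : ContinuousMap.toFun '' {z : C(Iic (0 : ℝ), E) | (∀ t, z t ∈ T) ∧
        ∀ ε > 0, ∀ s t, dist s t < δ ε → dist (z s) (z t) ≤ ε} =
        (Set.pi univ fun _ => T) ∩ {f : Iic (0 : ℝ) → E |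
          ∀ ε > 0, ∀ s t, dist s t < δ ε → dist (f s) (f t) ≤ ε} := by
      ext f
      constructor
      · rintro ⟨z, hz, rfl⟩
        exact ⟨fun t _ => hz.1 t, hz.2⟩
      · rintro ⟨h1, h2⟩
        have hf : Continuous f := by
          refine Metric.continuous_iff.2 fun t ε hε => ⟨δ (ε / 2), hδ _ (half_pos hε), ?_⟩
          exact fun s hs => (h2 _ (half_pos hε) s t hs).trans_lt (half_lt_self hε)
        exact ⟨⟨f, hf⟩, ⟨fun t => h1 t (mem_univ t), h2⟩, rfl⟩
    rw [himg]
    refine (isCompact_univ_pi fun _ => hT).inter_right ?_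
    simp only [ofPred_forall]
    refine isClosed_iInter fun ε => isClosed_iInter fun _ => isClosed_iInter fun s =>
      isClosed_iInter fun t => isClosed_iInter fun _ => ?_
    exact isClosed_le ((continuous_apply s).dist (continuous_apply t)) continuous_const
  · refine fun t => Metric.equicontinuousAt_iff_right.2 fun ε hε => ?_
    filter_upwards [Metric.ball_mem_nhds t (hδ _ (half_pos hε))] with s hs
    rintro ⟨z, hz⟩
    rw [Metric.mem_ball, dist_comm] at hs
    exact (hz.2 _ (half_pos hε) t s hs).trans_lt (half_lt_self hε)

section LevelSet

variable {S : DirichletEigensystem D} {Q : L2 D →L[ℝ] L2 D} {B : L2 D → L2 D}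

/-- Provides the qualitative bound `R` that the half-line estimate needs; it may depend on the path.
-/
theorem exists_bound_of_tendsto_zero {z : C(Iic (0 : ℝ), PhaseSpace S)}
    (h : Tendsto (fun t => ‖z t‖) atBot (𝓝 0)) : ∃ R, ∀ s ≤ 0, ‖IicExtend z s‖ ≤ R := by
  obtain ⟨t₀, ht₀⟩ := eventually_atBot.1 (h.eventually (gt_mem_nhds one_pos))
  obtain ⟨C, hC⟩ := (isCompact_Icc (a := (t₀ : ℝ)) (b := 0)).exists_bound_of_continuousOn
    (continuous_IicExtend z).continuousOn
  refine ⟨max C 1, fun s hs => ?_⟩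
  rcases le_total (t₀ : ℝ) s with h1 | h1
  · exact (hC s ⟨h1, hs⟩).trans (le_max_left _ _)
  · rw [IicExtend_of_mem _ (mem_Iic.2 hs)]
    exact (ht₀ ⟨s, hs⟩ h1).le.trans (le_max_right _ _)

/-- Bounded paths of finite action vanish at `-∞`. -/
theorem tendsto_norm_zero_of_halfLineAction_le {μ ν K M γ : ℝ} {hμ : 0 < μ}
    (hdec : UniformDecay S hμ ν K M) (hγ0 : 0 ≤ γ) (hKγ : K * γ < ν) (hB : Continuous B)
    (hBγ : ∀ u, ‖B u‖ ≤ γ * ‖u‖) {r R : ℝ} {z : C(Iic (0 : ℝ), PhaseSpace S)}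
    (h : halfLineAction S Q B hμ z ≤ ENNReal.ofReal r) (hR : ∀ t, ‖z t‖ ≤ R) :
    Tendsto (fun t => ‖z t‖) atBot (𝓝 0) := by
  obtain ⟨C, hC0, hC⟩ := exists_norm_apply_le_of_isDriven S Q hdec hγ0 hKγ hB hBγ
  have hM := hdec.const_pos
  set A := M * ‖forcingLift S μ‖ * C with hA
  have hA0 : 0 ≤ A := by positivity
  refine Metric.tendsto_nhds.2 fun ε hε => ?_
  -- The level is chosen so that the control norm is at most `ε / (A + 1)`, whence the path is at
  -- most `A ε / (A + 1) < ε` before `T`.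
  obtain ⟨T, hT, hdr⟩ := exists_isDriven_small hB h
    (show 0 < (ε / (A + 1)) ^ 2 / 2 by positivity)
  rw [mul_div_cancel₀ _ two_ne_zero, Real.sqrt_sq (by positivity)] at hdr
  filter_upwards [eventually_le_atBot (⟨T, hT.le⟩ : Iic (0 : ℝ))] with t ht
  have hext : IicExtend z (t : ℝ) = z t := IicExtend_of_mem _ t.2
  have h1 := hC T _ _ (continuous_IicExtend z) hdr R (fun s hs => hR _) (PhaseSpace S)
    (ContinuousLinearMap.id ℝ _) (fun _ => le_rfl) (M * ‖forcingLift S μ‖) (by positivity)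
    (fun τ hτ f => hdec.norm_forcing_le hτ f) t ht
  rw [ContinuousLinearMap.id_apply, hext, ← mul_assoc, ← hA, mul_div_assoc'] at h1
  rw [dist_zero_right, norm_norm]
  refine h1.trans_lt ?_
  rw [div_lt_iff₀ (by positivity)]
  linarith

/-- The paths in a level set have values in a common compact set. -/
theorem exists_isCompact_levelSet {μ ν K M γ : ℝ} {hμ : 0 < μ}
    (hα : Tendsto S.α atTop atTop)
    (hdec : UniformDecay S hμ ν K M) (hγ0 : 0 ≤ γ) (hKγ : K * γ < ν) (hB : Continuous B)
    (hBγ : ∀ u, ‖B u‖ ≤ γ * ‖u‖) {r : ℝ} (hr : 0 ≤ r) :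
    ∃ T : Set (PhaseSpace S), IsCompact T ∧ ∀ z ∈ levelSet S Q B hμ r, ∀ t, z t ∈ T := by
  obtain ⟨C, hC0, hC⟩ := exists_norm_apply_le_of_isDriven S Q hdec hγ0 hKγ hB hBγ
  have hM := hdec.const_pos
  set V : Set (PhaseSpace S) := {x | ∃ z ∈ levelSet S Q B hμ r, ∃ t, z t = x} with hV
  -- Used with `L` the identity for boundedness and with `L` a tail projection for total
  -- boundedness. The radius `√(2 * (r + 1))` comes from raising the level by `1`.
  have hest : ∀ x ∈ V, ∀ (L : PhaseSpace S →L[ℝ] PhaseSpace S), (∀ y, ‖L y‖ ≤ ‖y‖) →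
      ∀ c : ℝ, 0 ≤ c → (∀ t, 0 ≤ t → ∀ f, ‖L (semigroup S hμ t (forcingLift S μ f))‖ ≤
          c * Real.exp (-(ν * t)) * ‖f‖) → ‖L x‖ ≤ c * (C * √(2 * (r + 1))) := by
    rintro x ⟨z, hz, t, rfl⟩ L hL1 c hc hL
    obtain ⟨R, hR⟩ := exists_bound_of_tendsto_zero hz.1
    have h1 := hC 0 _ _ (continuous_IicExtend z)
      (isDriven_of_halfLineAction_le hr (lt_add_one r) hz.2) R hR _ L hL1 c hc hL t t.2
    rwa [IicExtend_of_mem _ t.2] at h1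
  have hbdd : Bornology.IsBounded V := by
    refine isBounded_iff_forall_norm_le.2
      ⟨M * ‖forcingLift S μ‖ * (C * √(2 * (r + 1))), fun x hx => ?_⟩
    exact hest x hx (ContinuousLinearMap.id ℝ _) (fun _ => le_rfl) _ (by positivity)
      (fun τ hτ f => hdec.norm_forcing_le hτ f)
  have htot : TotallyBounded V := by
    refine totallyBounded_of_tailProj S hbdd fun ε hε => ?_
    have hlim : Tendsto (fun m => M / (μ * √(S.α m)) * (C * √(2 * (r + 1)))) atTop
        (𝓝 (0 * (C * √(2 * (r + 1))))) := by
      refine Tendsto.mul_const _ (Tendsto.div_atTop tendsto_const_nhds ?_)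
      exact Tendsto.const_mul_atTop hμ (Real.tendsto_sqrt_atTop.comp hα)
    rw [zero_mul] at hlim
    obtain ⟨m, hm⟩ := (hlim.eventually (gt_mem_nhds hε)).exists
    exact ⟨m, fun x hx => (hest x hx (tailProj S m) (norm_tailProj_le S m) _ (by positivity)
      (hdec.tail_le m)).trans hm.le⟩
  exact ⟨closure V, htot.closure.isCompact_of_isClosed isClosed_closure,
    fun z hz t => subset_closure ⟨z, hz, t, rfl⟩⟩

/-- The semigroup converges to the identity uniformly on compact sets. -/
theorem exists_norm_semigroup_sub_lt {μ : ℝ} (hμ : 0 < μ) {T : Set (PhaseSpace S)}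
    (hT : IsCompact T) {ε : ℝ} (hε : 0 < ε) :
    ∃ δ > 0, ∀ h, 0 ≤ h → h < δ → ∀ x ∈ T, ‖semigroup S hμ h x - x‖ < ε := by
  have huc : UniformContinuousOn (fun p : ℝ × PhaseSpace S => semigroup S hμ p.1 p.2)
      (Icc (0 : ℝ) 1 ×ˢ T) :=
    (isCompact_Icc.prod hT).uniformContinuousOn_of_continuous
      (continuous_semigroup S hμ).continuousOn
  obtain ⟨δ, hδ, h⟩ := Metric.uniformContinuousOn_iff.1 huc ε hε
  refine ⟨min δ 1, lt_min hδ one_pos, fun t ht0 ht x hx => ?_⟩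
  have h1 := h (t, x) ⟨⟨ht0, (ht.trans_le (min_le_right _ _)).le⟩, hx⟩ (0, x)
    ⟨⟨le_rfl, zero_le_one⟩, hx⟩ (by
      rw [Prod.dist_eq, dist_self, Real.dist_eq, sub_zero, abs_of_nonneg ht0,
        max_eq_left ht0]
      exact ht.trans_le (min_le_left _ _))
  simpa [dist_eq_norm] using h1

/-- The paths in a level set are uniformly equicontinuous. -/
theorem exists_modulus_levelSet {μ ν K M γ : ℝ} {hμ : 0 < μ}
    (hdec : UniformDecay S hμ ν K M) (hγ0 : 0 ≤ γ) (hB : Continuous B)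
    (hBγ : ∀ u, ‖B u‖ ≤ γ * ‖u‖) {r : ℝ} (hr : 0 ≤ r) {T : Set (PhaseSpace S)}
    (hT : IsCompact T) (hzT : ∀ z ∈ levelSet S Q B hμ r, ∀ t, z t ∈ T) {ε : ℝ} (hε : 0 < ε) :
    ∃ δ > 0, ∀ z ∈ levelSet S Q B hμ r, ∀ s t, dist s t < δ → dist (z s) (z t) ≤ ε := by
  obtain ⟨X, hX⟩ := isBounded_iff_forall_norm_le.1 hT.isBounded
  have hM := hdec.const_pos
  obtain ⟨δ₁, hδ₁, h1⟩ := exists_norm_semigroup_sub_lt hμ hT (half_pos hε)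
  have hlim : Tendsto (fun h : ℝ => M * ‖forcingLift S μ‖ * (γ * X * h + ‖Q‖ *
      (√h * √(2 * (r + 1))))) (𝓝 0) (𝓝 0) := by
    have hc : Continuous (fun h : ℝ => M * ‖forcingLift S μ‖ * (γ * X * h + ‖Q‖ *
      (√h * √(2 * (r + 1))))) := by fun_prop
    simpa using hc.tendsto 0
  obtain ⟨δ₂, hδ₂, h2⟩ := Metric.eventually_nhds_iff.1
    (hlim.eventually (gt_mem_nhds (half_pos hε)))
  refine ⟨min δ₁ δ₂, lt_min hδ₁ hδ₂, fun z hz => ?_⟩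
  have key : ∀ s t : Iic (0 : ℝ), s ≤ t → dist s t < min δ₁ δ₂ → dist (z s) (z t) ≤ ε := by
    intro s t hst hd
    have hst' : (s : ℝ) ≤ t := hst
    have hd' : (t : ℝ) - s < min δ₁ δ₂ := by
      rw [Subtype.dist_eq, dist_comm, Real.dist_eq, abs_of_nonneg (sub_nonneg.2 hst')] at hd
      exact hd
    have hs0 : (s : ℝ) - 1 < 0 := by linarith [mem_Iic.1 s.2]
    -- Starting at `s - 1` ensures an initial time strictly below `0`, even for `s = 0`.
    obtain ⟨ψ, hψ, hψρ⟩ := isDriven_of_halfLineAction_le hr (lt_add_one r) hz.2 (s - 1) hs0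
    have h3 := hψ.norm_sub_le hdec hγ0 hB hBγ (continuous_IicExtend z) (X := X)
      (fun τ _ => (norm_fst_le S _).trans (hX _ (hzT z hz _))) (a := s) (b := t)
      (by linarith) hst' t.2
    rw [IicExtend_of_mem _ s.2, IicExtend_of_mem _ t.2] at h3
    have h4 := h1 (t - s) (sub_nonneg.2 hst') (hd'.trans_le (min_le_left _ _)) (z s)
      (hzT z hz s)
    have h5 := @h2 ((t : ℝ) - s) (by
      rw [dist_zero_right, Real.norm_of_nonneg (sub_nonneg.2 hst')]
      exact hd'.trans_le (min_le_right _ _))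
    have h6 : M * ‖forcingLift S μ‖ * (γ * X * ((t : ℝ) - s) + ‖Q‖ * (√((t : ℝ) - s) * ‖ψ‖)) ≤
        M * ‖forcingLift S μ‖ * (γ * X * ((t : ℝ) - s) + ‖Q‖ * (√((t : ℝ) - s) *
          √(2 * (r + 1)))) := by gcongr
    rw [dist_comm, dist_eq_norm]
    linarith
  intro s t hd
  rcases le_total s t with h | h
  · exact key s t h hd
  · rw [dist_comm] at hd ⊢
    exact key t s h hd

theorem isCompact_levelSet {μ ν K M γ : ℝ} {hμ : 0 < μ}
    (hα : Tendsto S.α atTop atTop) (hdec : UniformDecay S hμ ν K M) (hγ0 : 0 ≤ γ)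
    (hKγ : K * γ < ν) (hB0 : B 0 = 0) (hLip : ∀ u v, ‖B u - B v‖ ≤ γ * ‖u - v‖) {r : ℝ}
    (hr : 0 ≤ r) : IsCompact (levelSet S Q B hμ r) := by
  have hB : Continuous B := (LipschitzWith.of_dist_le_mul (K := ⟨γ, hγ0⟩) fun u v => by
    rw [dist_eq_norm, dist_eq_norm]
    exact hLip u v).continuous
  have hBγ : ∀ u, ‖B u‖ ≤ γ * ‖u‖ := fun u => by simpa [hB0] using hLip u 0
  obtain ⟨T, hT, hzT⟩ := exists_isCompact_levelSet (Q := Q) hα hdec hγ0 hKγ hB hBγ hr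
  have hmod : ∀ ε : ℝ, ∃ δ > 0, 0 < ε → ∀ z ∈ levelSet S Q B hμ r, ∀ s t, dist s t < δ →
      dist (z s) (z t) ≤ ε := by
    intro ε
    by_cases hε : 0 < ε
    · obtain ⟨δ, hδ, h⟩ := exists_modulus_levelSet hdec hγ0 hB hBγ hr hT hzT hε
      exact ⟨δ, hδ, fun _ => h⟩
    · exact ⟨1, one_pos, fun h => absurd h hε⟩
  choose δ hδ hmod using hmod
  refine isCompact_iff_ultrafilter_le_nhds.2 fun l hl => ?_
  rw [le_principal_iff] at hl
  -- The level set lies in an Arzelà–Ascoli compact set, which supplies a limit `z`; it remains to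
  -- see that `z` belongs to the level set.
  obtain ⟨z, hz, hlz⟩ := isCompact_iff_ultrafilter_le_nhds.1
    (isCompact_setOf_modulus hT (δ := δ) fun ε _ => hδ ε) l (by
      rw [le_principal_iff]
      exact mem_of_superset hl fun w hw => ⟨hzT w hw, fun ε hε => hmod ε hε w hw⟩)
  refine ⟨z, ?_, hlz⟩
  have hact : halfLineAction S Q B hμ z ≤ ENNReal.ofReal r := by
    refine iSup₂_le fun t ht => ?_
    refine action_le_of_tendstoUniformlyOn l hdec hB hLip hγ0 (neg_nonpos.2 ht.le) hr
      (w := fun w => IicExtend w) (fun w => continuous_IicExtend w) (continuous_IicExtend z) ?_ ?_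
    · have h1 := (ContinuousMap.tendsto_iff_forall_isCompact_tendstoUniformlyOn
        (F := fun w : C(Iic (0 : ℝ), PhaseSpace S) => w)).1 hlz
        (Subtype.val ⁻¹' Icc (-t) 0) (Topology.IsClosedEmbedding.isCompact_preimage
          isClosed_Iic.isClosedEmbedding_subtypeVal isCompact_Icc)
      refine Metric.tendstoUniformlyOn_iff.2 fun ε hε => ?_
      filter_upwards [Metric.tendstoUniformlyOn_iff.1 h1 ε hε] with w hw s hs
      rw [IicExtend_of_mem _ (mem_Iic.2 hs.2), IicExtend_of_mem _ (mem_Iic.2 hs.2)]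
      exact hw ⟨s, hs.2⟩ hs
    · exact mem_of_superset hl fun w hw =>
        (le_iSup₂ (f := fun (t : ℝ) (_ : 0 < t) => action S Q B hμ (-t) 0 (IicExtend w))
          t ht).trans hw.2
  obtain ⟨R, hR⟩ := isBounded_iff_forall_norm_le.1 hT.isBounded
  -- Vanishing at `-∞` is not closed under locally uniform convergence; it is deduced from the
  -- action bound and the boundedness of `T`.
  exact ⟨tendsto_norm_zero_of_halfLineAction_le hdec hγ0 hKγ hB hBγ hact
    fun t => hR _ (hz.1 t), hact⟩

end LevelSet

end DampedWave

end

theorem mainTheorem8 {d : ℕ} (hd : 1 ≤ d)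
    (D : Set (EuclideanSpace ℝ (Fin d))) (hD_open : IsOpen D) (hD_bdd : Bornology.IsBounded D)
    (S : DampedWave.DirichletEigensystem D) (hS : S.HasWeylGrowth)
    (β : ℝ) (hβ : ((d : ℝ) - 2) / 4 < β)
    (Q : DampedWave.L2 D →L[ℝ] DampedWave.L2 D) (hQ : DampedWave.IsDiagonalOfOrder S β Q)
    (B : DampedWave.L2 D → DampedWave.L2 D) (hB : DampedWave.IsAdmissibleNonlinearity S β B) :
    ∃ μ₀ : ℝ, 0 < μ₀ ∧ ∀ (μ : ℝ) (hμ : 0 < μ), μ ≤ μ₀ → ∀ r : ℝ, 0 < r →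
      IsCompact (DampedWave.levelSet S Q B hμ r) := by
  have hd' : (1 : ℝ) ≤ d := by exact_mod_cast hd
  -- From `d ≥ 1` one gets `β > -1/4`, so `0` belongs to `[0, 1 + 2β]`.
  obtain ⟨γ, hγ0, hγ, hLip⟩ := hB.exists_lipschitz (by linarith)
  obtain ⟨μ₀, hμ₀, h⟩ := DampedWave.exists_uniformDecay S hγ0 hγ
  refine ⟨μ₀, hμ₀, fun μ hμ hle r hr => ?_⟩
  obtain ⟨ν, K, M, hKγ, hdec⟩ := h μ hμ hle
  exact DampedWave.isCompact_levelSet (hS.tendsto_atTop hd) hdec hγ0 hKγ hB.map_zero hLip hr.le
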